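/- Let $\Pi$ be a (small) groupoid, let $A:\Pi\to\mathbf{Ab}$ be a $\Pi$-module, and let $n\ge 0$. Let $\widetilde A_1=\Pi\ltimes A$ be the semidirect product groupoid: its objects are those of $\Pi$, its arrows $x\to y$ are pairs $(u,a)$ with $u:x\to y$ in $\Pi$ and $a\in A(y)$, and $(v,b)\circ(u,a)=(vu,\,b+A(v)a)$. With the projection to $\Pi$ and the addition $(u,a)+(u,b)=(u,a+b)$ it is an abelian group object in the category $\mathbf{Gpd}/\Pi$ of groupoids over $\Pi$. Let $K(\widetilde A_1,n)$ be its Eilenberg–MacLane complex, a simplicial object of $\mathbf{Gpd}/\Pi$; here, for an abelian group object $X$ in a category with finite products, $K(X,n)_m$ is the product of copies of $X$ indexed by the surjective monotone maps $\sigma:[m]\to[n]$, and for $\theta:[m']\to[m]$ the $\tau$-component of $\theta^*$ is the sum of the projections to the components $\sigma$ with $\sigma\theta=\tau$ (so for abelian groups $K(X,n)$ is the simplicial abelian group that corresponds under Dold–Kan to $X$ placed in degree $n$). Let $\mathbf{SCrs}_1$ be the category of simplicial groupoids that have the same set of objects in all dimensions and whose faces and degeneracies are the identity on objects, and let $\overline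 W_1:\mathbf{SCrs}_1\to\mathbf{SSet}$ be the Dwyer–Kan classifying complex functor: the $m$-simplices of $\overline W_1(\Sigma)$ are the sequences of arrows $z_m\xrightarrow{u_{m-1}}z_{m-1}\to\cdots\to z_1\xrightarrow{u_0}z_0$ with $u_i$ in the groupoid $\Sigma_i$, with $$d_i(u_0,\dots,u_{m-1})=(u_0,\dots,u_{m-i-2},\,u_{m-i-1}\cdot d_0u_{m-i},\,d_1u_{m-i+1},\dots,d_{i-1}u_{m-1}),$$ $$s_i(u_0,\dots,u_{m-1})=(u_0,\dots,u_{m-i-1},\,\mathrm{id},\,s_0u_{m-i},\dots,s_{i-1}u_{m-1}).$$ For $\Pi$ regarded as a constant simplicial groupoid, $\overline W_1(\Pi)=\mathrm{Ner}(\Pi)$, so that $\overline W_1$ induces a functor $\mathbf{SCrs}_1/\Pi\to\mathbf{SSet}/\mathrm{Ner}(\Pi)$. Finally, let $L_\Pi(A,m)\to\mathrm{Ner}(\Pi)$ be the canonical projection from the homotopy colimit of the functor $x\mapsto K(A(x),m)$: its $k$-simplices are the pairs of a $k$-simplex $\xi=(x_0\to\cdots\to x_k)$ of $\mathrm{Ner}(\Pi)$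 and a $k$-simplex of $K(A(x_0),m)$, an operator $\theta$ acting on the second component by $\theta^*$ followed by transport along $x_0\to x_{\theta(0)}$. Then $K(\widetilde A_1,n)$ belongs to $\mathbf{SCrs}_1/\Pi$ (that is, it is isomorphic, as a simplicial groupoid over $\Pi$, to an object of $\mathbf{SCrs}_1/\Pi$), and for every object of $\mathbf{SCrs}_1/\Pi$ isomorphic to it there is an isomorphism in $\mathbf{SSet}/\mathrm{Ner}(\Pi)$ $$\overline W_1\bigl(K(\widetilde A_1,n)\bigr)\;\cong\;L_\Pi(A,n+1).$$ -/

import Mathlib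

open CategoryTheory Opposite Limits Simplicial

universe u v w

/-! ### Eilenberg–MacLane complexes -/

/-- The set of surjective monotone maps `a → b` (the degeneracy operators). -/
def DegeneracyOp (a b : SimplexCategory) : Type :=
  {σ : a ⟶ b // Function.Surjective σ.toOrderHom}

namespace DegeneracyOp

instance (a b : SimplexCategory) : Finite (DegeneracyOp a b) :=
  Finite.of_injective (fun σ : DegeneracyOp a b => (⇑σ.1.toOrderHom : _ → _)) (by
    intro σ τ h
    apply Subtype.ext
    apply SimplexCategory.Hom.ext
    exact DFunLike.coe_injective h)

noncomputable instance (a b : SimplexCategory) : Fintype (DegeneracyOp a b) := Fintype.ofFinite _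

open Classical in
/-- Transport of a family indexed by the surjections `a → b` along `θ : a' → a`:
the entry at `τ` of the result is the product of the entries at all `σ` with `σ ∘ θ = τ`. -/
@[to_additive
/-- Transport of a family indexed by the surjections `a → b` along `θ : a' → a`:
the entry at `τ` of the result is the sum of the entries at all `σ` with `σ ∘ θ = τ`. -/]
noncomputable def prodPull {M : Type*} [CommMonoid M] {a a' b : SimplexCategory} (θ : a' ⟶ a)
    (x : DegeneracyOp a b → M) : DegeneracyOp a' b → M :=
  fun τ => ∏ σ : DegeneracyOp a b with θ ≫ σ.1 = τ.1, x σ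

@[to_additive]
theorem prodPull_id {M : Type*} [CommMonoid M] {a b : SimplexCategory}
    (x : DegeneracyOp a b → M) : prodPull (𝟙 a) x = x := by
  classical
  funext τ
  unfold prodPull
  rw [Finset.prod_eq_single τ]
  · intro σ hσ hne
    exact absurd (Subtype.ext (by simpa using hσ)) hne
  · intro h
    simp at h

@[to_additive]
theorem prodPull_comp {M : Type*} [CommMonoid M] {a a' a'' b : SimplexCategory} (θ : a' ⟶ a)
    (φ : a'' ⟶ a') (x : DegeneracyOp a b → M) :
    prodPull (φ ≫ θ) x = prodPull φ (prodPull θ x) := by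
  classical
  funext τ
  unfold prodPull
  rw [Finset.prod_sigma']
  symm
  refine Finset.prod_bij (fun p _ => p.2) ?_ ?_ ?_ ?_
  · rintro ⟨ρ, σ⟩ h
    simp only [Finset.mem_sigma, Finset.mem_filter, Finset.mem_univ, true_and] at h ⊢
    rw [Category.assoc, h.2, h.1]
  · rintro ⟨ρ, σ⟩ h ⟨ρ', σ'⟩ h' e
    simp only [Finset.mem_sigma, Finset.mem_filter, Finset.mem_univ, true_and] at h h' e
    subst e
    have : ρ = ρ' := Subtype.ext (h.2.symm.trans h'.2)
    subst this
    rfl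
  · intro σ h
    simp only [Finset.mem_filter, Finset.mem_univ, true_and] at h
    have hs : Function.Surjective (θ ≫ σ.1).toOrderHom := by
      have h2 : Function.Surjective (φ ≫ θ ≫ σ.1).toOrderHom := by
        rw [← Category.assoc, h]
        exact τ.2
      intro y
      obtain ⟨z, hz⟩ := h2 y
      exact ⟨φ.toOrderHom z, hz⟩
    refine ⟨⟨⟨θ ≫ σ.1, hs⟩, σ⟩, ?_, rfl⟩
    refine Finset.mem_sigma.2 ⟨Finset.mem_filter.2 ⟨Finset.mem_univ _, ?_⟩,
      Finset.mem_filter.2 ⟨Finset.mem_univ _, rfl⟩⟩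
    rw [← h, Category.assoc]
  · intros
    rfl

theorem map_sumPull {M N : Type*} [AddCommMonoid M] [AddCommMonoid N] (f : M →+ N)
    {a a' b : SimplexCategory} (θ : a' ⟶ a) (x : DegeneracyOp a b → M) (τ : DegeneracyOp a' b) :
    f (sumPull θ x τ) = sumPull θ (fun σ => f (x σ)) τ := by
  unfold sumPull
  exact map_sum f _ _

end DegeneracyOp

/-- The Eilenberg–MacLane complex functor `A ↦ K(A, n)` from abelian groups to simplicial sets:
`K(A, n)_m` is the direct sum of copies of `A` indexed by the surjections `[m] → [n]`, i.e. the
value of the Dold–Kan functor on the chain complex with `A` in degree `n` and `0` elsewhere.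
An operator `θ` sends the summand of `σ` identically onto that of `σ ∘ θ` if this is surjective
and to zero otherwise. -/
noncomputable def eilenbergMacLaneFunctor (n : ℕ) : AddCommGrpCat.{u} ⥤ SSet.{u} where
  obj A :=
    { obj := fun m => DegeneracyOp m.unop ⦋n⦌ → A
      map := fun θ => ↾(fun x => DegeneracyOp.sumPull θ.unop x)
      map_id := fun m => by
        ext x τ
        exact congrFun (DegeneracyOp.sumPull_id x) τ
      map_comp := fun θ φ => by
        ext x τ
        exact congrFun (DegeneracyOp.sumPull_comp θ.unop φ.unop x) τ }
  map f :=
    { app := fun m => ↾(fun x σ => f.hom (x σ))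
      naturality := fun m m' θ => by
        ext x τ
        exact DegeneracyOp.map_sumPull f.hom θ.unop x τ }
  map_id A := by
    ext m x τ
    rfl
  map_comp f g := by
    ext m x τ
    rfl

section Internal

open MonObj

variable {E : Type v} [Category.{w} E] [CartesianMonoidalCategory E] [BraidedCategory E]

theorem comp_finset_prod (X : E) [GrpObj X] [IsCommMonObj X] {Y Z : E} (f : Y ⟶ Z) {J : Type*}
    (s : Finset J) (g : J → (Z ⟶ X)) : f ≫ ∏ i ∈ s, g i = ∏ i ∈ s, f ≫ g i :=
  map_prod (MonoidHom.mk' (fun h : Z ⟶ X => f ≫ h) (fun a b => MonObj.comp_mul f a b)) g s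

/-- The Eilenberg–MacLane complex `K(X, n)` of an abelian group object `X` of a category `E` with
finite products: `K(X, n)_m` is the product of copies of `X` indexed by the surjections
`[m] → [n]`, with the same operators as in the case of abelian groups (they are written with
products, because the abelian group `Hom(Y, X)` is written multiplicatively here). -/
noncomputable def eilenbergMacLane (X : E) [GrpObj X] [IsCommMonObj X] (n : ℕ) :
    SimplicialObject E where
  obj m := ∏ᶜ fun _ : DegeneracyOp m.unop ⦋n⦌ => X
  map θ := Pi.lift fun τ =>
    DegeneracyOp.prodPull θ.unop (fun σ => Pi.π (fun _ : DegeneracyOp _ ⦋n⦌ => X) σ) τ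
  map_id m := by
    apply Pi.hom_ext
    intro τ
    rw [Pi.lift_π, Category.id_comp]
    exact congrFun (DegeneracyOp.prodPull_id _) τ
  map_comp θ φ := by
    apply Pi.hom_ext
    intro τ
    rw [Pi.lift_π, Category.assoc, Pi.lift_π]
    refine (congrFun (DegeneracyOp.prodPull_comp θ.unop φ.unop _) τ).trans ?_
    unfold DegeneracyOp.prodPull
    rw [comp_finset_prod]
    refine Finset.prod_congr rfl fun σ _ => ?_
    rw [Pi.lift_π]

end Internal

/-! ### Homotopy colimits and generalized Eilenberg–MacLane complexes -/

section Hocolim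

variable {C : Type u} [Category.{u} C] (F : C ⥤ SSet.{u})

/-- An `m`-simplex of the homotopy colimit of `F`: a chain `x₀ → ⋯ → x_m` in `C` together with an
`m`-simplex of `F x₀`. -/
structure HocolimSimplex (m : SimplexCategoryᵒᵖ) : Type u where
  chain : ComposableArrows C m.unop.len
  fib : (F.obj (chain.obj 0)).obj m

variable {F} in
theorem HocolimSimplex.ext' {m : SimplexCategoryᵒᵖ} (s t : HocolimSimplex F m)
    (h : s.chain = t.chain)
    (h' : (F.map (eqToHom (congrArg (fun c => c.obj 0) h))).app m s.fib = t.fib) : s = t := by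
  obtain ⟨c, x⟩ := s
  obtain ⟨d, y⟩ := t
  dsimp only at h
  subst h
  simp only [eqToHom_refl, CategoryTheory.Functor.map_id] at h'
  exact congrArg _ h'

theorem hocolim_aux_id {m : SimplexCategoryᵒᵖ} {x : C} (f : x ⟶ x) (hf : f = 𝟙 x)
    (a : (F.obj x).obj m) :
    (F.map (𝟙 x)).app m ((F.map f).app m ((F.obj x).map (𝟙 m) a)) = a := by
  subst hf
  simp

theorem hocolim_aux_comp {m m' m'' : SimplexCategoryᵒᵖ} (θ : m ⟶ m') (φ : m' ⟶ m'') {x y z : C}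
    (f : x ⟶ y) (g : y ⟶ z) (k : x ⟶ z) (hk : k = f ≫ g) (a : (F.obj x).obj m) :
    (F.map (𝟙 z)).app m'' ((F.map k).app m'' ((F.obj x).map (θ ≫ φ) a)) =
      (F.map g).app m'' ((F.obj y).map φ ((F.map f).app m' ((F.obj x).map θ a))) := by
  subst hk
  have h2 := ConcreteCategory.congr_hom ((F.map f).naturality φ) ((F.obj x).map θ a)
  simp

/-- The homotopy colimit of `F : C ⥤ SSet` (the diagonal of the simplicial replacement). An
operator `θ` restricts the chain along `θ` and moves the simplex of `F x₀` to `F x_{θ 0}`. -/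
def hocolim : SSet.{u} where
  obj m := HocolimSimplex F m
  map {m m'} θ := ↾(fun s =>
    { chain := θ.unop.toOrderHom.monotone.functor ⋙ s.chain
      fib := (F.map (s.chain.map (homOfLE (Fin.zero_le (θ.unop.toOrderHom 0))))).app m'
        ((F.obj (s.chain.obj 0)).map θ s.fib) })
  map_id m := by
    ext s
    refine HocolimSimplex.ext' _ _ rfl ?_
    exact hocolim_aux_id F _ (s.chain.map_id 0) s.fib
  map_comp {m m' m''} θ φ := by
    ext s
    refine HocolimSimplex.ext' _ _ rfl ?_
    exact hocolim_aux_comp F θ φ _ _ _ (s.chain.map_comp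
      (homOfLE (Fin.zero_le (θ.unop.toOrderHom 0)))
      (homOfLE (θ.unop.toOrderHom.monotone (Fin.zero_le (φ.unop.toOrderHom 0))))) s.fib

/-- The canonical projection of the homotopy colimit to the nerve. -/
def hocolimProj : hocolim F ⟶ nerve C where
  app _ := ↾(fun s => s.chain)
  naturality _ _ _ := rfl

/-- `L_P(A, m)`: the canonical projection to the nerve of `P` from the homotopy colimit of
`x ↦ K(A(x), m)`, as an object over `Ner(P)`. -/
noncomputable def generalizedEilenbergMacLane {P : Type u} [Groupoid.{u} P]
    (A : P ⥤ AddCommGrpCat.{u}) (m : ℕ) : Over (nerve P) :=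
  Over.mk (hocolimProj (A ⋙ eilenbergMacLaneFunctor m))

end Hocolim

/-! ### Fibre products of groupoids -/

section GrpdPullback

variable {B C D : Type u} [Groupoid.{u} B] [Groupoid.{u} C] [Groupoid.{u} D]

/-- Objects of the strict fibre product of two functors of groupoids. -/
@[ext]
structure GrpdFibreProduct (F : C ⥤ B) (G : D ⥤ B) : Type u where
  fst : C
  snd : D
  w : F.obj fst = G.obj snd

namespace GrpdFibreProduct

variable {F : C ⥤ B} {G : D ⥤ B}

instance : Groupoid.{u} (GrpdFibreProduct F G) where
  Hom x y := {p : (x.fst ⟶ y.fst) × (x.snd ⟶ y.snd) //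
    F.map p.1 ≫ eqToHom y.w = eqToHom x.w ≫ G.map p.2}
  id x := ⟨(𝟙 _, 𝟙 _), by simp⟩
  comp {x y z} p q := ⟨(p.1.1 ≫ q.1.1, p.1.2 ≫ q.1.2), by
    rw [Functor.map_comp, Category.assoc, q.2, ← Category.assoc, p.2, Category.assoc,
      Functor.map_comp]⟩
  inv {x y} p := ⟨(Groupoid.inv p.1.1, Groupoid.inv p.1.2), by
    have h := p.2
    dsimp only
    rw [Groupoid.inv_eq_inv, Groupoid.inv_eq_inv, Functor.map_inv, Functor.map_inv,
      IsIso.inv_comp_eq, ← Category.assoc, IsIso.eq_comp_inv]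
    exact h.symm⟩
  inv_comp p := Subtype.ext (Prod.ext (Groupoid.inv_comp _) (Groupoid.inv_comp _))
  comp_inv p := Subtype.ext (Prod.ext (Groupoid.comp_inv _) (Groupoid.comp_inv _))

variable (F G)

/-- The first projection. -/
def fstFunctor : GrpdFibreProduct F G ⥤ C where
  obj x := x.fst
  map p := p.1.1

/-- The second projection. -/
def sndFunctor : GrpdFibreProduct F G ⥤ D where
  obj x := x.snd
  map p := p.1.2

theorem condition : fstFunctor F G ⋙ F = sndFunctor F G ⋙ G :=
  CategoryTheory.Functor.ext (fun x => x.w) (fun x y p => by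
    have h : F.map p.1.1 ≫ eqToHom y.w = eqToHom x.w ≫ G.map p.1.2 := p.2
    change F.map p.1.1 = eqToHom x.w ≫ G.map p.1.2 ≫ eqToHom y.w.symm
    rw [← Category.assoc, ← h]
    simp)

variable {F G}

/-- The universal functor to the fibre product. -/
def lift {T : Type u} [Groupoid.{u} T] (H : T ⥤ C) (K : T ⥤ D) (e : H ⋙ F = K ⋙ G) :
    T ⥤ GrpdFibreProduct F G where
  obj t := ⟨H.obj t, K.obj t, Functor.congr_obj e t⟩
  map f := ⟨(H.map f, K.map f), by
    have h := Functor.congr_hom e f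
    simp only [Functor.comp_map] at h
    rw [h]
    simp⟩
  map_id t := Subtype.ext (Prod.ext (H.map_id t) (K.map_id t))
  map_comp f g := Subtype.ext (Prod.ext (H.map_comp f g) (K.map_comp f g))

theorem functor_ext {T : Type u} [Groupoid.{u} T] {H K : T ⥤ GrpdFibreProduct F G}
    (h1 : H ⋙ fstFunctor F G = K ⋙ fstFunctor F G)
    (h2 : H ⋙ sndFunctor F G = K ⋙ sndFunctor F G) : H = K := by
  have hobj : ∀ t, H.obj t = K.obj t := fun t =>
    GrpdFibreProduct.ext (Functor.congr_obj h1 t) (Functor.congr_obj h2 t)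
  refine CategoryTheory.Functor.hext hobj fun s t f => ?_
  have e1 := Functor.hcongr_hom h1 f
  have e2 := Functor.hcongr_hom h2 f
  have key : ∀ {x x' y y' : GrpdFibreProduct F G} (p : x ⟶ y) (q : x' ⟶ y'), x = x' → y = y' →
      p.1.1 ≍ q.1.1 → p.1.2 ≍ q.1.2 → p ≍ q := by
    intro x x' y y' p q hx hy h h'
    subst hx hy
    exact heq_of_eq (Subtype.ext (Prod.ext (eq_of_heq h) (eq_of_heq h')))
  exact key _ _ (hobj s) (hobj t) e1 e2

end GrpdFibreProduct

instance : HasPullbacks Grpd.{u, u} :=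
  have : ∀ {X Y Z : Grpd.{u, u}} {F : X ⟶ Z} {G : Y ⟶ Z}, HasLimit (cospan F G) :=
    fun {X Y Z F G} =>
      HasLimit.mk ⟨PullbackCone.mk (W := Grpd.of (GrpdFibreProduct (B := Z) (C := X) (D := Y) F G))
        (GrpdFibreProduct.fstFunctor (B := Z) (C := X) (D := Y) F G)
        (GrpdFibreProduct.sndFunctor (B := Z) (C := X) (D := Y) F G)
        (GrpdFibreProduct.condition (B := Z) (C := X) (D := Y) F G),
        PullbackCone.IsLimit.mk _
          (fun s => GrpdFibreProduct.lift (B := Z) (C := X) (D := Y) s.fst s.snd s.condition)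
          (fun _ => rfl) (fun _ => rfl)
          (fun _ _ h1 h2 => GrpdFibreProduct.functor_ext (B := Z) (C := X) (D := Y) h1 h2)⟩
  hasPullbacks_of_hasLimit_cospan _

end GrpdPullback

/-! ### The semidirect product as an abelian group object over `P` -/

section Semidirect

variable {P : Type u} [Groupoid.{u} P] (A : P ⥤ AddCommGrpCat.{u})

/-- Objects of the semidirect product (Grothendieck construction) `P ⋉ A`: those of `P`. -/
structure Semidirect (A : P ⥤ AddCommGrpCat.{u}) : Type u where
  pt : P

/-- An arrow `x → y` of `P ⋉ A` is a pair `(u, a)` with `u : x → y` in `P` and `a ∈ A(y)`. -/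
@[ext]
structure SemidirectHom {A : P ⥤ AddCommGrpCat.{u}} (x y : Semidirect A) : Type u where
  base : x.pt ⟶ y.pt
  elt : A.obj y.pt

/-- The composition is `(v, b) ∘ (u, a) = (v ∘ u, b + A(v)(a))`. -/
instance : Groupoid.{u} (Semidirect A) where
  Hom x y := SemidirectHom x y
  id x := ⟨𝟙 x.pt, 0⟩
  comp p q := ⟨p.base ≫ q.base, q.elt + A.map q.base p.elt⟩
  inv p := ⟨Groupoid.inv p.base, -(A.map (Groupoid.inv p.base) p.elt)⟩
  id_comp p := SemidirectHom.ext (Category.id_comp _) (by simp)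
  comp_id p := SemidirectHom.ext (Category.comp_id _) (by simp)
  assoc p q r := SemidirectHom.ext (Category.assoc _ _ _) (by simp [add_assoc])
  inv_comp p := by
    refine SemidirectHom.ext (Groupoid.inv_comp _) ?_
    change p.elt + A.map p.base (-(A.map (Groupoid.inv p.base) p.elt)) = 0
    rw [map_neg, ← CategoryTheory.comp_apply, ← A.map_comp, Groupoid.inv_comp]
    simp
  comp_inv p := by
    refine SemidirectHom.ext (Groupoid.comp_inv _) ?_
    change -(A.map (Groupoid.inv p.base) p.elt) + A.map (Groupoid.inv p.base) p.elt = 0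
    simp

/-- The canonical projection `P ⋉ A → P`. -/
def semidirectProj : Semidirect A ⥤ P where
  obj x := x.pt
  map p := p.base
  map_id _ := rfl
  map_comp _ _ := rfl

/-- The semidirect product `P ⋉ A` as an object of the category of groupoids over `P`. -/
def semidirectOver : Over (Grpd.of P) :=
  Over.mk (X := Grpd.of P) (Y := Grpd.of (Semidirect A)) (semidirectProj A)

theorem map_eqToHom_trans {x y z : P} (h : x = y) (h' : y = z) (h'' : x = z) (a : A.obj x) :
    A.map (eqToHom h'') a = A.map (eqToHom h') (A.map (eqToHom h) a) := by
  subst h h'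
  simp

section Derivations

variable {A} {T : Type u} [Groupoid.{u} T]

/-- The abelian group, under pointwise addition, of crossed homomorphisms along a functor
`p : T ⥤ P`: families `d(f) ∈ A(p y)`, for `f : x → y` in `T`, with
`d(g ∘ f) = d(g) + A(p g)(d(f))`. -/
def crossedHoms (A : P ⥤ AddCommGrpCat.{u}) (p : T ⥤ P) :
    AddSubgroup (∀ x y : T, (x ⟶ y) → A.obj (p.obj y)) where
  carrier := {d | ∀ {x y z : T} (f : x ⟶ y) (g : y ⟶ z),
    d x z (f ≫ g) = d y z g + A.map (p.map g) (d x y f)}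
  zero_mem' := by
    intro x y z f g
    simp
  add_mem' {d e} hd he := by
    intro x y z f g
    simp only [Pi.add_apply]
    rw [hd, he, map_add]
    abel
  neg_mem' {d} hd := by
    intro x y z f g
    simp only [Pi.neg_apply]
    rw [hd, map_neg, neg_add]

/-- Restriction of crossed homomorphisms along a functor over `P`. -/
def crossedHomsComp (A : P ⥤ AddCommGrpCat.{u}) {S : Type u} [Groupoid.{u} S] {p : T ⥤ P}
    {q : S ⥤ P} (φ : S ⥤ T) (h : φ ⋙ p = q) : crossedHoms A p →+ crossedHoms A q where
  toFun d := ⟨fun x y f => A.map (eqToHom (Functor.congr_obj h y)) (d.1 _ _ (φ.map f)), by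
    subst h
    intro x y z f g
    have h := d.2 (φ.map f) (φ.map g)
    rw [← φ.map_comp] at h
    simpa using h⟩
  map_zero' := by
    ext
    simp
  map_add' d e := by
    ext
    simp

/-- Functors `T → P ⋉ A` over `P` are the same as crossed homomorphisms. -/
def semidirectLiftEquiv (A : P ⥤ AddCommGrpCat.{u}) (p : T ⥤ P) :
    {H : T ⥤ Semidirect A // H ⋙ semidirectProj A = p} ≃ crossedHoms A p where
  toFun H := ⟨fun x y f => A.map (eqToHom (Functor.congr_obj H.2 y)) (H.1.map f).elt, by
    obtain ⟨H, rfl⟩ := H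
    intro x y z f g
    have h : (H.map (f ≫ g)).elt = (H.map g).elt + A.map (H.map g).base (H.map f).elt :=
      congrArg SemidirectHom.elt (H.map_comp f g)
    change A.map (𝟙 _) (H.map (f ≫ g)).elt = A.map (𝟙 _) (H.map g).elt +
      A.map (H.map g).base (A.map (𝟙 _) (H.map f).elt)
    rw [h]
    simp⟩
  invFun d :=
    ⟨{ obj := fun x => ⟨p.obj x⟩
       map := fun {x y} f => ⟨p.map f, d.1 x y f⟩
       map_id := fun x => by
         have h := d.2 (𝟙 x) (𝟙 x)
         rw [Category.comp_id, p.map_id, A.map_id, CategoryTheory.id_apply] at h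
         exact SemidirectHom.ext (p.map_id x) (left_eq_add.1 h)
       map_comp := fun f g => SemidirectHom.ext (p.map_comp f g) (d.2 f g) }, rfl⟩
  left_inv H := by
    obtain ⟨H, rfl⟩ := H
    apply Subtype.ext
    refine CategoryTheory.Functor.hext (fun x => rfl) (fun x y f => heq_of_eq ?_)
    refine SemidirectHom.ext rfl ?_
    change A.map (𝟙 _) (H.map f).elt = (H.map f).elt
    simp
  right_inv d := by
    apply Subtype.ext
    funext x y f
    change A.map (𝟙 _) (d.1 x y f) = d.1 x y f
    simp

end Derivations

/-- The presheaf of abelian groups on groupoids over `P` of crossed homomorphisms. -/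
def crossedHomPresheaf : (Over (Grpd.of P))ᵒᵖ ⥤ CommGrpCat.{u} where
  obj Y := CommGrpCat.of (Multiplicative (crossedHoms (T := Y.unop.left) A Y.unop.hom))
  map f := CommGrpCat.ofHom (AddMonoidHom.toMultiplicative
    (crossedHomsComp A f.unop.left (Over.w f.unop)))
  map_id Y := by
    ext d
    apply Subtype.ext
    funext x y f
    change A.map (𝟙 _) (d.1 x y f) = d.1 x y f
    simp
  map_comp {Y Y' Y''} f g := by
    ext d
    apply Subtype.ext
    funext x y k
    change A.map (eqToHom _) (d.1 _ _ _) = A.map (eqToHom _) (A.map (eqToHom _) (d.1 _ _ _))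
    exact map_eqToHom_trans A _ _ _ _

/-- `P ⋉ A` represents the presheaf of crossed homomorphisms. -/
def semidirectRepresentableBy :
    (crossedHomPresheaf A ⋙ forget _).RepresentableBy (semidirectOver A) where
  homEquiv {Y} :=
    { toFun := fun H => semidirectLiftEquiv (T := Y.left) A Y.hom ⟨H.left, Over.w H⟩
      invFun := fun d => Over.homMk ((semidirectLiftEquiv (T := Y.left) A Y.hom).symm d).1
        ((semidirectLiftEquiv (T := Y.left) A Y.hom).symm d).2
      left_inv := fun H => Over.OverMorphism.ext (congrArg Subtype.val
        ((semidirectLiftEquiv (T := Y.left) A Y.hom).symm_apply_apply ⟨H.left, Over.w H⟩))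
      right_inv := fun d => (semidirectLiftEquiv (T := Y.left) A Y.hom).apply_symm_apply d }
  homEquiv_comp := by
    intro Y Y' f g
    apply Subtype.ext
    funext x y k
    change A.map (eqToHom _) _ = A.map (eqToHom _) (A.map (eqToHom _) _)
    exact map_eqToHom_trans A _ _ _ _

attribute [local instance] Over.cartesianMonoidalCategory Over.braidedCategory

/-- The abelian group structure of `P ⋉ A` over `P`: the product of two functors `T → P ⋉ A` over
`P`, of components `(u, a)` and `(u, b)` at an arrow of `T`, has the component `(u, a + b)`. -/
noncomputable instance : CommGrpObj (semidirectOver A) :=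
  CommGrpObj.ofRepresentableBy _ (crossedHomPresheaf A) (semidirectRepresentableBy A)

/-- The simplicial object `K(P ⋉ A, n)` of the category of groupoids over `P`, where `P ⋉ A` is
seen as an abelian group object over `P`. -/
noncomputable def semidirectEilenbergMacLane (n : ℕ) : SimplicialObject (Over (Grpd.of P)) :=
  eilenbergMacLane (semidirectOver A) n

end Semidirect

/-! ### Simplicial groupoids with a fixed set of objects -/

/-- A groupoid with set of objects `O`. -/
structure GroupoidOn (O : Type u) where
  str : Groupoid.{u} O

namespace GroupoidOn

variable {O : Type u}

/-- The arrows `x → y` of `G`. -/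
def Arr (G : GroupoidOn O) (x y : O) : Type u := G.str.toCategory.toCategoryStruct.toQuiver.Hom x y

/-- The identity arrow of `x` in `G`. -/
def one (G : GroupoidOn O) (x : O) : G.Arr x x := G.str.toCategory.toCategoryStruct.id x

/-- The composite `x → y → z` in `G`, in diagrammatic order. -/
def seq (G : GroupoidOn O) {x y z : O} (p : G.Arr x y) (q : G.Arr y z) : G.Arr x z :=
  G.str.toCategory.toCategoryStruct.comp p q

theorem seq_assoc (G : GroupoidOn O) {w x y z : O} (p : G.Arr w x) (q : G.Arr x y)
    (r : G.Arr y z) : G.seq (G.seq p q) r = G.seq p (G.seq q r) :=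
  G.str.toCategory.assoc p q r

theorem one_seq (G : GroupoidOn O) {x y : O} (p : G.Arr x y) : G.seq (G.one x) p = p :=
  G.str.toCategory.id_comp p

theorem seq_one (G : GroupoidOn O) {x y : O} (p : G.Arr x y) : G.seq p (G.one y) = p :=
  G.str.toCategory.comp_id p

/-- A functor between groupoids on `O` that is the identity on objects. -/
@[ext]
structure Hom (G H : GroupoidOn O) where
  map : ∀ {x y : O}, G.Arr x y → H.Arr x y
  map_one : ∀ x, map (G.one x) = H.one x
  map_seq : ∀ {x y z : O} (p : G.Arr x y) (q : G.Arr y z), map (G.seq p q) = H.seq (map p) (map q)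

instance : Category (GroupoidOn O) where
  Hom G H := Hom G H
  id G := { map := fun p => p, map_one := fun _ => rfl, map_seq := fun _ _ => rfl }
  comp F F' :=
    { map := fun p => F'.map (F.map p)
      map_one := fun x => by rw [F.map_one, F'.map_one]
      map_seq := fun p q => by rw [F.map_seq, F'.map_seq] }

/-- The set `O`, seen as the type of objects of the groupoid `G`. -/
def Carrier (_ : GroupoidOn O) : Type u := O

instance (G : GroupoidOn O) : Groupoid.{u} G.Carrier := G.str

/-- The inclusion into the category of all groupoids. -/
def toGrpd (O : Type u) : GroupoidOn O ⥤ Grpd.{u, u} where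
  obj G := Grpd.of G.Carrier
  map {G H} F := CategoryTheory.Functor.mk (C := G.Carrier) (D := H.Carrier)
    (fun x => x) (fun {x y} p => F.map (x := x) (y := y) p) F.map_one F.map_seq
  map_id _ := rfl
  map_comp _ _ := rfl

end GroupoidOn

/-- A simplicial groupoid whose groupoids of `m`-simplices all have the same set of objects `Obj`,
and whose operators are all the identity on objects. -/
structure SCrs₁ where
  Obj : Type u
  lvl : SimplicialObject (GroupoidOn Obj)

namespace SCrs₁

/-- The arrows `x → y` of the groupoid of `m`-simplices. -/
def Arr (S : SCrs₁.{u}) (m : SimplexCategory) (x y : S.Obj) : Type u := (S.lvl.obj (op m)).Arr x y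

/-- The identity of `x` in the groupoid of `m`-simplices. -/
def one (S : SCrs₁.{u}) (m : SimplexCategory) (x : S.Obj) : S.Arr m x x := (S.lvl.obj (op m)).one x

/-- The composite `x → y → z` in the groupoid of `m`-simplices. -/
def seq (S : SCrs₁.{u}) {m : SimplexCategory} {x y z : S.Obj} (p : S.Arr m x y) (q : S.Arr m y z) :
    S.Arr m x z := (S.lvl.obj (op m)).seq p q

/-- The action of a simplicial operator on arrows. -/
def act (S : SCrs₁.{u}) {m m' : SimplexCategory} (θ : m' ⟶ m) {x y : S.Obj} (p : S.Arr m x y) :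
    S.Arr m' x y := GroupoidOn.Hom.map (S.lvl.map θ.op) p

theorem act_id (S : SCrs₁.{u}) {m : SimplexCategory} {x y : S.Obj} (p : S.Arr m x y) :
    S.act (𝟙 m) p = p := by
  have h : S.lvl.map (𝟙 m).op = 𝟙 _ := S.lvl.map_id (op m)
  unfold act
  rw [h]
  rfl

theorem act_comp (S : SCrs₁.{u}) {m m' m'' : SimplexCategory} (θ : m' ⟶ m) (φ : m'' ⟶ m')
    {x y : S.Obj} (p : S.Arr m x y) : S.act (φ ≫ θ) p = S.act φ (S.act θ p) := by
  have h : S.lvl.map (φ ≫ θ).op = S.lvl.map θ.op ≫ S.lvl.map φ.op := S.lvl.map_comp θ.op φ.op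
  unfold act
  rw [h]
  rfl

theorem act_one (S : SCrs₁.{u}) {m m' : SimplexCategory} (θ : m' ⟶ m) (x : S.Obj) :
    S.act θ (S.one m x) = S.one m' x := GroupoidOn.Hom.map_one (S.lvl.map θ.op) x

theorem act_seq (S : SCrs₁.{u}) {m m' : SimplexCategory} (θ : m' ⟶ m) {x y z : S.Obj}
    (p : S.Arr m x y) (q : S.Arr m y z) : S.act θ (S.seq p q) = S.seq (S.act θ p) (S.act θ q) :=
  GroupoidOn.Hom.map_seq (S.lvl.map θ.op) p q

/-- A morphism of `SCrs₁`: a simplicial functor, given in all dimensions by the same map on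
objects. -/
@[ext]
structure Hom (S T : SCrs₁.{u}) where
  obj : S.Obj → T.Obj
  map : ∀ {m : SimplexCategory} {x y : S.Obj}, S.Arr m x y → T.Arr m (obj x) (obj y)
  map_one : ∀ (m : SimplexCategory) (x : S.Obj), map (S.one m x) = T.one m (obj x)
  map_seq : ∀ {m : SimplexCategory} {x y z : S.Obj} (p : S.Arr m x y) (q : S.Arr m y z),
    map (S.seq p q) = T.seq (map p) (map q)
  map_act : ∀ {m m' : SimplexCategory} (θ : m' ⟶ m) {x y : S.Obj} (p : S.Arr m x y),
    map (S.act θ p) = T.act θ (map p)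

instance : Category SCrs₁.{u} where
  Hom S T := Hom S T
  id S :=
    { obj := fun x => x
      map := fun p => p
      map_one := fun _ _ => rfl
      map_seq := fun _ _ => rfl
      map_act := fun _ _ _ _ => rfl }
  comp F F' :=
    { obj := fun x => F'.obj (F.obj x)
      map := fun p => F'.map (F.map p)
      map_one := fun m x => by rw [F.map_one, F'.map_one]
      map_seq := fun p q => by rw [F.map_seq, F'.map_seq]
      map_act := fun θ _ _ p => by rw [F.map_act, F'.map_act] }

/-- The inclusion of `SCrs₁` into the category of simplicial groupoids. -/
def incl : SCrs₁.{u} ⥤ SimplicialObject Grpd.{u, u} where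
  obj S := S.lvl ⋙ GroupoidOn.toGrpd S.Obj
  map {S T} F :=
    { app := fun m => CategoryTheory.Functor.mk (C := (S.lvl.obj m).Carrier)
        (D := (T.lvl.obj m).Carrier) F.obj (fun {x y} p => F.map (m := m.unop) (x := x) (y := y) p)
        (F.map_one m.unop) F.map_seq
      naturality := fun m m' θ => by
        refine CategoryTheory.Functor.hext (fun x => rfl) (fun x y p => heq_of_eq ?_)
        exact F.map_act θ.unop p }
  map_id _ := rfl
  map_comp _ _ := rfl

/-- A groupoid `P`, regarded as a constant simplicial groupoid. -/
def const (P : Type u) [Groupoid.{u} P] : SCrs₁.{u} where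
  Obj := P
  lvl := (CategoryTheory.Functor.const _).obj ⟨inferInstance⟩

/-- The inclusion of `SCrs₁/P` into the category of simplicial objects of the category of
groupoids over `P`. -/
def overIncl {P : Type u} [Groupoid.{u} P] (S : Over (const P)) :
    SimplicialObject (Over (Grpd.of P)) :=
  Over.lift (incl.obj S.left) (X := Grpd.of P) (incl.map S.hom)

end SCrs₁

/-! ### The classifying complex -/

/-- For `θ : [m] → [n]`, `j ≤ m` and `k ≤ θ j`, the restriction `{j, …, m} → {k, …, n}` of `θ`,
where `{j, …, m}` and `{k, …, n}` are identified with `[m - j]` and `[n - k]`. -/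
def tailHom {a b : SimplexCategory} (θ : a ⟶ b) (j : Fin (a.len + 1)) (k : Fin (b.len + 1))
    (_ : k ≤ θ.toOrderHom j) : ⦋a.len - j⦌ ⟶ ⦋b.len - k⦌ :=
  SimplexCategory.mkHom
    { toFun := fun i => ⟨(θ.toOrderHom ⟨j + i, by
          have h1 : (i : ℕ) < a.len - j + 1 := i.2
          omega⟩ : ℕ) - k, by
          omega⟩
      monotone' := fun i i' hi => by
        apply Fin.mk_le_mk.2
        apply Nat.sub_le_sub_right
        apply Fin.le_def.1
        apply θ.toOrderHom.monotone
        exact Fin.mk_le_mk.2 (Nat.add_le_add_left (Fin.le_def.1 hi) _) }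

theorem tailHom_id {a : SimplexCategory} (j : Fin (a.len + 1)) (h : j ≤ j) :
    tailHom (𝟙 a) j j h = 𝟙 ⦋a.len - j⦌ := by
  apply SimplexCategory.Hom.ext
  apply OrderHom.ext
  funext i
  apply Fin.ext
  change (j + i : ℕ) - j = i
  exact Nat.add_sub_cancel_left _ _

theorem tailHom_comp {a b c : SimplexCategory} (θ : a ⟶ b) (φ : b ⟶ c) (j : Fin (a.len + 1))
    (k : Fin (b.len + 1)) (l : Fin (c.len + 1)) (h : k ≤ θ.toOrderHom j)
    (h' : l ≤ φ.toOrderHom k) (h'' : l ≤ (θ ≫ φ).toOrderHom j) :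
    tailHom θ j k h ≫ tailHom φ k l h' = tailHom (θ ≫ φ) j l h'' := by
  apply SimplexCategory.Hom.ext
  apply OrderHom.ext
  funext i
  apply Fin.ext
  change (φ.toOrderHom ⟨k + ((θ.toOrderHom ⟨j + i, _⟩ : ℕ) - k), _⟩ : ℕ) - l =
    (φ.toOrderHom (θ.toOrderHom ⟨j + i, _⟩) : ℕ) - l
  congr 3
  apply Fin.ext
  have h1 : θ.toOrderHom j ≤ θ.toOrderHom ⟨j + i, by
    have h1 : (i : ℕ) < a.len - j + 1 := i.2
    omega⟩ := θ.toOrderHom.monotone (Fin.le_def.2 (Nat.le_add_right _ _))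
  have h2 := Fin.le_def.1 (h.trans h1)
  exact Nat.add_sub_cancel' h2

namespace SCrs₁

/-- An `n`-simplex of the classifying complex of `S`: vertices `x₀, …, x_n` and arrows
`x_i → x_j` (`i ≤ j`) of the groupoid of `(n - j)`-simplices, where `[n - j]` stands for
`{j, …, n}`, such that for `i ≤ j ≤ k` the arrow `x_i → x_k` is the composite of the restriction
of `x_i → x_j` to `{k, …, n}` (an iterate of `d₀`) with `x_j → x_k`.

In the notation `(z_n → z_{n-1} → ⋯ → z_0)`, `u_i : z_{i+1} → z_i` in dimension `i`, for such a
simplex, one has `z_i = x_{n-i}` and `u_i` is the arrow `x_{n-i-1} → x_{n-i}`; these arrows are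
arbitrary and determine all the others. -/
@[ext]
structure WBarSimplex (S : SCrs₁.{u}) (n : SimplexCategory) where
  vertex : Fin (n.len + 1) → S.Obj
  arrow : ∀ i j : Fin (n.len + 1), i ≤ j → S.Arr ⦋n.len - j⦌ (vertex i) (vertex j)
  arrow_self : ∀ i, arrow i i le_rfl = S.one _ (vertex i)
  arrow_trans : ∀ (i j k : Fin (n.len + 1)) (hij : i ≤ j) (hjk : j ≤ k),
    arrow i k (hij.trans hjk) =
      S.seq (S.act (tailHom (𝟙 n) k j hjk) (arrow i j hij)) (arrow j k hjk)

/-- The arrows `x_i → x_{i+1}` of a simplex of the classifying complex are arbitrary and determine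
all the others. -/
theorem WBarSimplex.existsUnique_of_spine (S : SCrs₁.{u}) (n : SimplexCategory)
    (x : Fin (n.len + 1) → S.Obj)
    (u : ∀ i : Fin n.len, S.Arr ⦋n.len - (i.succ : Fin (n.len + 1))⦌ (x i.castSucc) (x i.succ)) :
    ∃! a : (∀ i j : Fin (n.len + 1), i ≤ j → S.Arr ⦋n.len - j⦌ (x i) (x j)),
      (∀ i, a i i le_rfl = S.one _ (x i)) ∧
      (∀ (i j k : Fin (n.len + 1)) (hij : i ≤ j) (hjk : j ≤ k), a i k (hij.trans hjk) =
        S.seq (S.act (tailHom (𝟙 n) k j hjk) (a i j hij)) (a j k hjk)) ∧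
      ∀ i : Fin n.len, a i.castSucc i.succ (Fin.castSucc_le_succ i) = u i := by
  let B : ∀ (i : Fin (n.len + 1)) {m : ℕ} (_ : (i : ℕ) ≤ m) (hm : m < n.len + 1),
      S.Arr ⦋n.len - m⦌ (x i) (x ⟨m, hm⟩) := fun i {m} h =>
    Nat.leRec (motive := fun m _ => ∀ hm : m < n.len + 1, S.Arr ⦋n.len - m⦌ (x i) (x ⟨m, hm⟩))
      (fun _ => S.one _ (x i))
      (fun k _ ih hm => S.seq
        (S.act (tailHom (𝟙 n) ⟨k + 1, hm⟩ ⟨k, by omega⟩ (Nat.le_succ k)) (ih (by omega)))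
        (u ⟨k, by omega⟩)) h
  have B0 : ∀ i : Fin (n.len + 1), B i le_rfl i.2 = S.one _ (x i) := fun i =>
    congrFun (Nat.leRec_self (motive := fun m _ => ∀ hm : m < n.len + 1,
      S.Arr ⦋n.len - m⦌ (x i) (x ⟨m, hm⟩)) _ _) _
  have B1 : ∀ (i : Fin (n.len + 1)) {k : ℕ} (h : (i : ℕ) ≤ k) (hm : k + 1 < n.len + 1),
      B i (Nat.le_succ_of_le h) hm = S.seq
        (S.act (tailHom (𝟙 n) ⟨k + 1, hm⟩ ⟨k, by omega⟩ (Nat.le_succ k)) (B i h (by omega)))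
        (u ⟨k, by omega⟩) := fun i {k} h hm =>
    congrFun (Nat.leRec_succ (motive := fun m _ => ∀ hm : m < n.len + 1,
      S.Arr ⦋n.len - m⦌ (x i) (x ⟨m, hm⟩)) _ _ h) hm
  have Bt : ∀ (i j : Fin (n.len + 1)) (hij : i ≤ j) (k : ℕ) (hjk : (j : ℕ) ≤ k)
      (hk : k < n.len + 1), B i (le_trans (Fin.le_def.1 hij) hjk) hk =
        S.seq (S.act (tailHom (𝟙 n) ⟨k, hk⟩ j hjk) (B i (Fin.le_def.1 hij) j.2))
          (B j hjk hk) := by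
    intro i j hij k hjk
    induction k, hjk using Nat.le_induction with
    | base =>
      intro hk
      have e := B0 j
      have e2 : S.act (tailHom (𝟙 n) j j le_rfl) (B i (Fin.le_def.1 hij) j.2) =
          B i (Fin.le_def.1 hij) j.2 :=
        (congrArg (fun t => S.act t (B i (Fin.le_def.1 hij) j.2)) (tailHom_id j le_rfl)).trans
          (S.act_id _)
      exact ((congrArg₂ S.seq e2 e).trans ((S.lvl.obj _).seq_one _)).symm
    | succ k hjk ih =>
      intro hk
      have hk' : k < n.len + 1 := by omega
      rw [B1 i (le_trans (Fin.le_def.1 hij) hjk) hk, B1 j hjk hk, ih hk', S.act_seq, ← S.act_comp,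
        tailHom_comp (𝟙 n) (𝟙 n) ⟨k + 1, hk⟩ ⟨k, hk'⟩ j (Nat.le_succ k) hjk
          (Nat.le_succ_of_le hjk)]
      exact (S.lvl.obj _).seq_assoc _ _ _
  refine ⟨fun i j h => B i (Fin.le_def.1 h) j.2, ⟨B0, fun i j k hij hjk =>
    Bt i j hij k (Fin.le_def.1 hjk) k.2, fun i => ?_⟩, ?_⟩
  · refine (B1 i.castSucc le_rfl i.succ.2).trans ?_
    refine (congrArg (fun t => S.seq (S.act _ t) (u i)) (B0 i.castSucc)).trans ?_
    refine (congrArg (fun t => S.seq t (u i)) (S.act_one _ _)).trans ?_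
    exact (S.lvl.obj _).one_seq _
  · rintro a ⟨h0, ht, hu⟩
    have key : ∀ (i : Fin (n.len + 1)) (k : ℕ) (h : (i : ℕ) ≤ k) (hk : k < n.len + 1),
        a i ⟨k, hk⟩ h = B i h hk := by
      intro i k h
      induction k, h using Nat.le_induction with
      | base => exact fun _ => (h0 i).trans (B0 i).symm
      | succ k h ih =>
        intro hk
        have hk' : k < n.len + 1 := by omega
        have e := ht i ⟨k, hk'⟩ ⟨k + 1, hk⟩ h (Nat.le_succ k)
        have e' : a ⟨k, hk'⟩ ⟨k + 1, hk⟩ (Nat.le_succ k) = u ⟨k, by omega⟩ := hu ⟨k, by omega⟩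
        rw [ih hk', e'] at e
        exact e.trans (B1 i h hk).symm
    funext i j h
    exact key i j (Fin.le_def.1 h) j.2

/-- The action of an operator `θ : [m] → [n]` on simplices of the classifying complex: the arrow
`x_{θ i} → x_{θ j}` is restricted along `θ : {j, …, m} → {θ j, …, n}`. For the coface
`θ = δ^i` the arrows of the spine are thus `d_{i-1} u_{n-1}, …, d₁ u_{n-i+1}`, the composite
`u_{n-i-1} ∘ d₀ u_{n-i}`, and `u_{n-i-2}, …, u₀`. For the codegeneracy `σ^i` they are
`s_{i-1} u_{n-1}, …, s₀ u_{n-i}`, an identity, and `u_{n-i-1}, …, u₀`. -/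
def WBarSimplex.pull {S : SCrs₁.{u}} {m n : SimplexCategory} (θ : m ⟶ n) (s : WBarSimplex S n) :
    WBarSimplex S m where
  vertex i := s.vertex (θ.toOrderHom i)
  arrow i j h := S.act (tailHom θ j (θ.toOrderHom j) le_rfl)
    (s.arrow _ _ (θ.toOrderHom.monotone h))
  arrow_self i := by
    rw [s.arrow_self, S.act_one]
  arrow_trans i j k hij hjk := by
    rw [s.arrow_trans _ _ _ (θ.toOrderHom.monotone hij) (θ.toOrderHom.monotone hjk), S.act_seq,
      ← S.act_comp, ← S.act_comp]
    have e : tailHom θ k (θ.toOrderHom k) le_rfl ≫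
        tailHom (𝟙 n) (θ.toOrderHom k) (θ.toOrderHom j) (θ.toOrderHom.monotone hjk) =
        tailHom (𝟙 m) k j hjk ≫ tailHom θ j (θ.toOrderHom j) le_rfl := by
      rw [tailHom_comp θ (𝟙 n) k _ _ le_rfl (θ.toOrderHom.monotone hjk)
          (θ.toOrderHom.monotone hjk),
        tailHom_comp (𝟙 m) θ k j _ hjk le_rfl (θ.toOrderHom.monotone hjk)]
      rfl
    rw [e]

theorem WBarSimplex.pull_id {S : SCrs₁.{u}} {n : SimplexCategory} (s : WBarSimplex S n) :
    s.pull (𝟙 n) = s := by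
  refine WBarSimplex.ext rfl (heq_of_eq ?_)
  funext i j h
  exact (congrArg (fun t => S.act t (s.arrow i j h)) (tailHom_id j le_rfl)).trans (S.act_id _)

theorem WBarSimplex.pull_comp {S : SCrs₁.{u}} {m' m n : SimplexCategory} (φ : m' ⟶ m) (θ : m ⟶ n)
    (s : WBarSimplex S n) : s.pull (φ ≫ θ) = (s.pull θ).pull φ := by
  refine WBarSimplex.ext rfl (heq_of_eq ?_)
  funext i j h
  exact (congrArg (fun t => S.act t (s.arrow _ _
    (θ.toOrderHom.monotone (φ.toOrderHom.monotone h))))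
      (tailHom_comp φ θ j _ _ le_rfl le_rfl le_rfl).symm).trans (S.act_comp _ _ _)

/-- The classifying complex functor from `SCrs₁` to simplicial sets. -/
def wBar : SCrs₁.{u} ⥤ SSet.{u} where
  obj S :=
    { obj := fun n => WBarSimplex S n.unop
      map := fun θ => ↾(fun s => s.pull θ.unop)
      map_id := fun _ => ConcreteCategory.hom_ext _ _ fun s => s.pull_id
      map_comp := fun θ φ => ConcreteCategory.hom_ext _ _ fun s => s.pull_comp φ.unop θ.unop }
  map {S T} F :=
    { app := fun _ => ↾(fun s =>
        { vertex := fun i => F.obj (s.vertex i)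
          arrow := fun i j h => F.map (s.arrow i j h)
          arrow_self := fun i => by rw [s.arrow_self, F.map_one]
          arrow_trans := fun i j k hij hjk => by
            rw [s.arrow_trans i j k hij hjk, F.map_seq, F.map_act] })
      naturality := fun _ _ θ => by
        apply ConcreteCategory.hom_ext
        intro s
        refine WBarSimplex.ext rfl (heq_of_eq ?_)
        funext i j h
        exact F.map_act _ _ }
  map_id _ := rfl
  map_comp _ _ := rfl

/-- The classifying complex of a constant simplicial groupoid is the nerve. -/
def wBarConst (P : Type u) [Groupoid.{u} P] : wBar.obj (const P) ≅ nerve P :=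
  NatIso.ofComponents (fun _ =>
    { hom := ↾(fun s =>
        { obj := fun i => s.vertex i
          map := fun f => s.arrow _ _ (leOfHom f)
          map_id := fun i => s.arrow_self i
          map_comp := fun f g => s.arrow_trans _ _ _ (leOfHom f) (leOfHom g) })
      inv := ↾(fun c =>
        { vertex := fun i => c.obj i
          arrow := fun _ _ h => c.map (homOfLE h)
          arrow_self := fun i => c.map_id i
          arrow_trans := fun _ _ _ hij hjk => c.map_comp (homOfLE hij) (homOfLE hjk) })
      hom_inv_id := rfl
      inv_hom_id := rfl }) (fun _ => rfl)

/-- The classifying complex of an object of `SCrs₁/P`, as a simplicial set over `Ner(P)`. -/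
def wBarOver (P : Type u) [Groupoid.{u} P] : Over (const P) ⥤ Over (nerve P) :=
  Over.post wBar ⋙ Over.map (wBarConst P).hom

end SCrs₁

/-!
The groupoid of `m`-simplices of `K(P ⋉ A, n)` is, up to isomorphism over `P`, the semidirect
product `P ⋉ A^J`, where `J` is the set of surjections `[m] → [n]`: morphisms over `P` from a
groupoid to `P ⋉ A` are crossed homomorphisms with values in `A` (`crossedHomOf`), and those with
values in `A^J` are families of such (`semidirectPowerIsLimit`). The groupoids `P ⋉ A^J` may be
given the common set of objects `P`; this yields the standard model `semidirectSCrs₁Over A n` in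
`SCrs₁/P`. The components of an isomorphism from any other model to `K(P ⋉ A, n)` are crossed
homomorphisms as well, and they define a morphism of `SCrs₁/P` to the standard model
(`compareHom`) that is bijective on objects and arrows. Hence the classifying complexes of all
models are isomorphic over `Ner(P)`, and only the standard one has to be considered.

For the standard model, an `m`-simplex of the classifying complex is a chain `x₀ → ⋯ → x_m` in `P`
together with elements `a_{ij}` of `A(x_j)^{J_j}`, where `J_j` is the set of surjections
`{j, …, m} → [n]`, that satisfy the cocycle condition `a_{ik} = a_{jk} + (a_{ij})|_{k, …, m}` up
to transport along the chain. After transport to `x₀` this is the classical isomorphism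
`W̄ K(M, n) ≅ K(M, n + 1)`, made explicit as follows. A simplex of `K(M, n + 1)` is a family `c(σ)`
indexed by the surjections `σ : [m] → [n + 1]`; the corresponding cocycle (`delooping`) is
`a_{ij}(τ) = ∑ c(σ)`, where `σ` runs over the surjections with `σ(i) = 0` and `σ = τ + 1` on
`{j, …, m}`. The cocycle condition (`delooping_trans`) holds because such a `σ` for the pair
`i < k` vanishes or is positive at `j`, and compatibility with operators (`delooping_sumPull`)
holds because both sides are a sum of `c(σ)` over the same `σ`. Bijectivity follows from the
spine: a surjection `σ : [m] → [n + 1]` amounts to its last zero `i` and a surjection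
`{i + 1, …, m} → [n]` (`existsUnique_suspends`, `existsUnique_desuspension`), so that
`a_{i,i+1}(τ)` is a single `c(σ)` and each `c(σ)` occurs once, while a simplex of the classifying
complex is determined by an arbitrary spine.
-/

/-! ### Suspension of degeneracy operators -/

namespace DegeneracyOp

section Suspension

variable {a b : SimplexCategory} {n : ℕ}

/-- For `j ≤ m` and `t ≤ m - j`, the vertex `j + t` of `[m]`; this identifies `[m - j]` with the
final segment `{j, …, m}`. -/
def tailVertex {a : SimplexCategory} (j : Fin (a.len + 1)) (t : Fin (a.len - j + 1)) :
    Fin (a.len + 1) :=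
  ⟨j + t, by
    have h1 : (t : ℕ) < a.len - j + 1 := t.2
    omega⟩

/-- The relation between a surjection `σ : [m] → [n + 1]` and a surjection
`τ : {j, …, m} → [n]` that `σ` vanishes at `i` and restricts to `τ + 1` on `{j, …, m}`. -/
def Suspends (i j : Fin (a.len + 1)) (τ : DegeneracyOp ⦋a.len - j⦌ ⦋n⦌)
    (σ : DegeneracyOp a ⦋n + 1⦌) : Prop :=
  (σ.1.toOrderHom i : ℕ) = 0 ∧
    ∀ t : Fin (a.len - j + 1), (σ.1.toOrderHom (tailVertex j t) : ℕ) = τ.1.toOrderHom t + 1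

theorem ext_val {σ τ : DegeneracyOp a b}
    (h : ∀ t, (σ.1.toOrderHom t : ℕ) = τ.1.toOrderHom t) : σ = τ := by
  apply Subtype.ext
  apply SimplexCategory.Hom.ext
  apply OrderHom.ext
  funext t
  exact Fin.ext (h t)

/-- The map `σ - 1 : {k, …, m} → [n]`, for `σ : [m] → [n + 1]`; the subtraction is truncated, so
that this is meaningful only if `σ` is positive at `k`. -/
def lowerHom (σ : a ⟶ ⦋n + 1⦌) (k : Fin (a.len + 1)) :
    ⦋a.len - k⦌ ⟶ ⦋n⦌ :=
  SimplexCategory.mkHom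
    { toFun := fun t => ⟨(σ.toOrderHom (tailVertex k t) : ℕ) - 1, by
          have h1 : (σ.toOrderHom (tailVertex k t) : ℕ) < n + 1 + 1 :=
            (σ.toOrderHom (tailVertex k t)).2
          have h2 : ((⦋n⦌ : SimplexCategory)).len = n := rfl
          omega⟩
      monotone' := fun t t' ht => by
        apply Fin.mk_le_mk.2
        apply Nat.sub_le_sub_right
        apply Fin.le_def.1
        apply σ.toOrderHom.monotone
        exact Fin.mk_le_mk.2 (Nat.add_le_add_left (Fin.le_def.1 ht) _) }

theorem lowerHom_val (σ : a ⟶ ⦋n + 1⦌) (k : Fin (a.len + 1)) (hk : (σ.toOrderHom k : ℕ) ≠ 0)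
    (t : Fin (a.len - k + 1)) :
    (σ.toOrderHom (tailVertex k t) : ℕ) = (lowerHom σ k).toOrderHom t + 1 := by
  have h1 : (σ.toOrderHom k : ℕ) ≤ σ.toOrderHom (tailVertex k t) :=
    Fin.le_def.1 (σ.toOrderHom.monotone (Fin.le_def.2 (Nat.le_add_right _ _)))
  change _ = (σ.toOrderHom (tailVertex k t) : ℕ) - 1 + 1
  omega

theorem tailVertex_tailHom (θ : a ⟶ b) (j : Fin (a.len + 1)) (k : Fin (b.len + 1))
    (h : k ≤ θ.toOrderHom j) (t : Fin (a.len - j + 1)) :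
    tailVertex k ((tailHom θ j k h).toOrderHom t) = θ.toOrderHom (tailVertex j t) := by
  apply Fin.ext
  have h1 : θ.toOrderHom j ≤ θ.toOrderHom (tailVertex j t) :=
    θ.toOrderHom.monotone (Fin.le_def.2 (Nat.le_add_right _ _))
  exact Nat.add_sub_cancel' (Fin.le_def.1 (h.trans h1))

theorem tailVertex_zero (j : Fin (a.len + 1)) : tailVertex j 0 = j := Fin.ext (Nat.add_zero _)

theorem exists_tailVertex {j t : Fin (a.len + 1)} (h : j ≤ t) : ∃ s, tailVertex j s = t :=
  ⟨⟨t - j, by omega⟩, Fin.ext (Nat.add_sub_cancel' (Fin.le_def.1 h))⟩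

open Classical in
/-- The component `x_i → x_j` of the simplex of `W̄ K(M, n)` that corresponds to the simplex `c`
of `K(M, n + 1)`: at `τ : {j, …, m} → [n]` it is the sum of the entries of `c` at all surjections
`σ : [m] → [n + 1]` that vanish at `i` and restrict to `τ + 1` on `{j, …, m}`. -/
noncomputable def delooping {M : Type*} [AddCommMonoid M] (c : DegeneracyOp a ⦋n + 1⦌ → M)
    (i j : Fin (a.len + 1)) : DegeneracyOp ⦋a.len - j⦌ ⦋n⦌ → M :=
  fun τ => ∑ σ with Suspends i j τ σ, c σ

variable {M : Type*} [AddCommMonoid M]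

theorem map_delooping {N : Type*} [AddCommMonoid N] (f : M →+ N) (c : DegeneracyOp a ⦋n + 1⦌ → M)
    (i j : Fin (a.len + 1)) (τ : DegeneracyOp ⦋a.len - j⦌ ⦋n⦌) :
    f (delooping c i j τ) = delooping (fun σ => f (c σ)) i j τ :=
  map_sum f _ _

theorem delooping_self (c : DegeneracyOp a ⦋n + 1⦌ → M) (i : Fin (a.len + 1)) :
    delooping c i i = 0 := by
  classical
  funext τ
  refine Finset.sum_eq_zero fun σ h => ?_
  obtain ⟨h0, h1⟩ := (Finset.mem_filter.1 h).2
  have h2 := h1 0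
  rw [tailVertex_zero] at h2
  omega

open Classical in
/-- The restriction of `delooping c l k` along `θ : {j, …} → {k, …}`, as a single sum: the
intermediate surjection on `{k, …}` has to be `σ - 1`. -/
theorem sumPull_tailHom_delooping (c : DegeneracyOp b ⦋n + 1⦌ → M) (θ : a ⟶ b)
    (j : Fin (a.len + 1)) (k l : Fin (b.len + 1)) (h : k ≤ θ.toOrderHom j)
    (τ : DegeneracyOp ⦋a.len - j⦌ ⦋n⦌) :
    sumPull (tailHom θ j k h) (delooping c l k) τ =
      ∑ σ : DegeneracyOp b ⦋n + 1⦌ with (σ.1.toOrderHom l : ℕ) = 0 ∧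
        (σ.1.toOrderHom k : ℕ) ≠ 0 ∧ ∀ t : Fin (a.len - j + 1),
          (σ.1.toOrderHom (θ.toOrderHom (tailVertex j t)) : ℕ) = τ.1.toOrderHom t + 1, c σ := by
  unfold sumPull delooping
  rw [Finset.sum_sigma']
  refine Finset.sum_bij (fun p _ => p.2) ?_ ?_ ?_ ?_
  · rintro ⟨ρ, σ⟩ hp
    simp only [Finset.mem_sigma, Finset.mem_filter, Finset.mem_univ, true_and] at hp ⊢
    obtain ⟨hρ, h0, h1⟩ := hp
    refine ⟨h0, ?_, fun t => ?_⟩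
    · have h2 := h1 0
      rw [tailVertex_zero] at h2
      omega
    · rw [← tailVertex_tailHom θ j k h t, ← hρ]
      exact h1 _
  · rintro ⟨ρ, σ⟩ hp ⟨ρ', σ'⟩ hp' e
    simp only [Finset.mem_sigma, Finset.mem_filter, Finset.mem_univ, true_and] at hp hp' e
    subst e
    have : ρ = ρ' := ext_val fun t => by
      have h1 := hp.2.2 t
      have h2 := hp'.2.2 t
      omega
    subst this
    rfl
  · intro σ hσ
    simp only [Finset.mem_filter, Finset.mem_univ, true_and] at hσ
    obtain ⟨h0, hk, h1⟩ := hσ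
    have e : tailHom θ j k h ≫ lowerHom σ.1 k = τ.1 := by
      apply SimplexCategory.Hom.ext
      apply OrderHom.ext
      funext t
      apply Fin.ext
      have h2 := lowerHom_val σ.1 k hk ((tailHom θ j k h).toOrderHom t)
      rw [tailVertex_tailHom, h1] at h2
      exact (Nat.succ_injective h2).symm
    have hs : Function.Surjective (lowerHom σ.1 k).toOrderHom := by
      intro y
      obtain ⟨t, ht⟩ := τ.2 y
      rw [← e] at ht
      exact ⟨_, ht⟩
    refine ⟨⟨⟨lowerHom σ.1 k, hs⟩, σ⟩, ?_, rfl⟩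
    exact Finset.mem_sigma.2 ⟨Finset.mem_filter.2 ⟨Finset.mem_univ _, e⟩,
      Finset.mem_filter.2 ⟨Finset.mem_univ _, h0, lowerHom_val σ.1 k hk⟩⟩
  · intros
    rfl

/-- The cocycle condition: a surjection that vanishes at `i` either vanishes at `j` or does not. -/
theorem delooping_trans (c : DegeneracyOp a ⦋n + 1⦌ → M) (i j k : Fin (a.len + 1)) (hij : i ≤ j)
    (hjk : j ≤ k) : delooping c i k =
      delooping c j k + sumPull (tailHom (𝟙 a) k j hjk) (delooping c i j) := by
  classical
  funext τ
  refine Eq.trans ?_ (congrArg (delooping c j k τ + ·)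
    (sumPull_tailHom_delooping c (𝟙 a) k j i hjk τ).symm)
  unfold delooping
  rw [← Finset.sum_union]
  · refine Finset.sum_congr ?_ fun _ _ => rfl
    ext σ
    have hm : (σ.1.toOrderHom i : ℕ) ≤ σ.1.toOrderHom j := σ.1.toOrderHom.monotone hij
    constructor
    · intro h
      obtain ⟨h0, h1⟩ := (Finset.mem_filter.1 h).2
      by_cases hj : (σ.1.toOrderHom j : ℕ) = 0
      · exact Finset.mem_union_left _ (Finset.mem_filter.2 ⟨Finset.mem_univ _, hj, h1⟩)
      · exact Finset.mem_union_right _ (Finset.mem_filter.2 ⟨Finset.mem_univ _, h0, hj, h1⟩)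
    · intro h
      refine Finset.mem_filter.2 ⟨Finset.mem_univ _, ?_⟩
      rcases Finset.mem_union.1 h with h | h
      · obtain ⟨h0, h1⟩ := (Finset.mem_filter.1 h).2
        exact ⟨by omega, h1⟩
      · obtain ⟨h0, -, h1⟩ := (Finset.mem_filter.1 h).2
        exact ⟨h0, h1⟩
  · rw [Finset.disjoint_left]
    intro σ h h'
    exact (Finset.mem_filter.1 h').2.2.1 (Finset.mem_filter.1 h).2.1

theorem delooping_sumPull (c : DegeneracyOp b ⦋n + 1⦌ → M) (θ : a ⟶ b) (i j : Fin (a.len + 1)) :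
    delooping (sumPull θ c) i j = sumPull (tailHom θ j (θ.toOrderHom j) le_rfl)
      (delooping c (θ.toOrderHom i) (θ.toOrderHom j)) := by
  classical
  funext τ
  rw [sumPull_tailHom_delooping]
  unfold sumPull delooping
  rw [Finset.sum_sigma']
  refine Finset.sum_bij (fun p _ => p.2) ?_ ?_ ?_ ?_
  · rintro ⟨ρ, σ⟩ hp
    simp only [Finset.mem_sigma, Finset.mem_filter, Finset.mem_univ, true_and] at hp ⊢
    obtain ⟨⟨h0, h1⟩, e⟩ := hp
    rw [← e] at h0 h1
    refine ⟨h0, ?_, h1⟩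
    have h2 : (σ.1.toOrderHom (θ.toOrderHom (tailVertex j 0)) : ℕ) = _ := h1 0
    rw [tailVertex_zero] at h2
    omega
  · rintro ⟨ρ, σ⟩ hp ⟨ρ', σ'⟩ hp' e
    simp only [Finset.mem_sigma, Finset.mem_filter, Finset.mem_univ, true_and] at hp hp' e
    subst e
    have : ρ = ρ' := Subtype.ext (hp.2.symm.trans hp'.2)
    subst this
    rfl
  · intro σ hσ
    simp only [Finset.mem_filter, Finset.mem_univ, true_and] at hσ
    obtain ⟨h0, -, h1⟩ := hσ
    have hs : Function.Surjective (θ ≫ σ.1).toOrderHom := by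
      intro y
      obtain hy | ⟨z, hz⟩ := Fin.eq_zero_or_eq_succ (n := n + 1) y
      · exact ⟨i, Fin.ext (h0.trans (congrArg Fin.val hy).symm)⟩
      · obtain ⟨t, ht⟩ := τ.2 z
        refine ⟨tailVertex j t, Fin.ext ((h1 t).trans ?_)⟩
        rw [ht, hz]
        rfl
    refine ⟨⟨⟨θ ≫ σ.1, hs⟩, σ⟩, ?_, rfl⟩
    exact Finset.mem_sigma.2 ⟨Finset.mem_filter.2 ⟨Finset.mem_univ _, h0, h1⟩,
      Finset.mem_filter.2 ⟨Finset.mem_univ _, rfl⟩⟩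
  · intros
    rfl

/-- A surjection `[m] → [n + 1]` is the same as a first vertex `i + 1` at which it is positive and
a surjection `{i + 1, …, m} → [n]`. -/
theorem existsUnique_suspends (i : Fin a.len)
    (τ : DegeneracyOp ⦋a.len - (i.succ : Fin (a.len + 1))⦌ ⦋n⦌) :
    ∃! σ : DegeneracyOp a ⦋n + 1⦌, Suspends i.castSucc i.succ τ σ := by
  have hlt : ∀ t : Fin (a.len + 1), (t : ℕ) - (i + 1) < a.len - (i + 1) + 1 := by
    intro t
    have := i.2
    have := t.2
    omega
  -- `σ` is `0` up to `i` by monotonicity, and `τ + 1` from `i + 1` on.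
  have hval : ∀ σ : DegeneracyOp a ⦋n + 1⦌, Suspends i.castSucc i.succ τ σ →
      ∀ t : Fin (a.len + 1), (σ.1.toOrderHom t : ℕ) =
        if h : t ≤ i.castSucc then 0 else (τ.1.toOrderHom ⟨t - (i + 1), hlt t⟩ : ℕ) + 1 := by
    intro σ h t
    split_ifs with ht
    · have := σ.1.toOrderHom.monotone ht
      have h0 := h.1
      exact Nat.le_zero.1 (h0 ▸ Fin.le_def.1 this)
    · have ht' : i.succ ≤ t := by
        rw [Fin.le_def] at ht ⊢
        simp at ht ⊢
        omega
      refine Eq.trans ?_ (h.2 ⟨t - (i + 1), hlt t⟩)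
      congr 2
      apply Fin.ext
      exact (Nat.add_sub_cancel' (Fin.le_def.1 ht')).symm
  let f : Fin (a.len + 1) → Fin (n + 1 + 1) := fun t =>
    if h : t ≤ i.castSucc then 0 else (τ.1.toOrderHom ⟨t - (i + 1), hlt t⟩).succ
  have f0 : f i.castSucc = 0 := dif_pos le_rfl
  have f1 : ∀ t : Fin (a.len - (i.succ : Fin (a.len + 1)) + 1), f (tailVertex i.succ t) =
      (τ.1.toOrderHom t).succ := by
    intro t
    have ht : ¬ tailVertex i.succ t ≤ i.castSucc := by
      rw [Fin.le_def]
      change ¬ ((i : ℕ) + 1 + t ≤ i)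
      omega
    refine (dif_neg ht).trans ?_
    congr 2
    apply Fin.ext
    exact Nat.add_sub_cancel_left _ _
  have hmono : Monotone f := by
    intro s t hst
    by_cases hs : s ≤ i.castSucc
    · exact (dif_pos hs).trans_le (Fin.zero_le _)
    · have ht : ¬ t ≤ i.castSucc := fun h => hs (hst.trans h)
      refine (dif_neg hs).trans_le (le_of_le_of_eq ?_ (dif_neg ht).symm)
      apply Fin.succ_le_succ_iff.2
      apply τ.1.toOrderHom.monotone
      exact Fin.mk_le_mk.2 (Nat.sub_le_sub_right (Fin.le_def.1 hst) _)
  have hsurj : Function.Surjective f := by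
    intro y
    obtain rfl | ⟨z, rfl⟩ := Fin.eq_zero_or_eq_succ y
    · exact ⟨_, f0⟩
    · obtain ⟨t, ht⟩ := τ.2 z
      exact ⟨_, (f1 t).trans (congrArg Fin.succ ht)⟩
  refine ⟨⟨SimplexCategory.mkHom (n := a.len) (m := n + 1) ⟨f, hmono⟩, hsurj⟩,
    ⟨congrArg Fin.val f0, fun t => congrArg Fin.val (f1 t)⟩, fun σ hσ => ext_val fun t => ?_⟩
  rw [hval σ hσ t]
  change _ = (f t : ℕ)
  simp only [f]
  split_ifs <;> rfl

/-- Every surjection `[m] → [n + 1]` arises in this way, uniquely. -/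
theorem existsUnique_desuspension (σ : DegeneracyOp a ⦋n + 1⦌) :
    ∃! p : Σ i : Fin a.len, DegeneracyOp ⦋a.len - (i.succ : Fin (a.len + 1))⦌ ⦋n⦌,
      Suspends p.1.castSucc p.1.succ p.2 σ := by
  obtain ⟨s, hs⟩ := σ.2 (1 : Fin (n + 1 + 1))
  have h0 : (σ.1.toOrderHom 0 : ℕ) = 0 := by
    obtain ⟨t, ht⟩ := σ.2 (0 : Fin (n + 1 + 1))
    have := Fin.le_def.1 (σ.1.toOrderHom.monotone (Fin.zero_le t))
    rw [ht] at this
    exact Nat.le_zero.1 this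
  have hex : ∃ i : ℕ, ∃ h : i < a.len + 1, (σ.1.toOrderHom ⟨i, h⟩ : ℕ) ≠ 0 :=
    ⟨s, s.2, by
      change (σ.1.toOrderHom s : ℕ) ≠ 0
      rw [hs]
      exact one_ne_zero⟩
  classical
  obtain ⟨hk, hk'⟩ := Nat.find_spec hex
  obtain ⟨i, hi⟩ : ∃ i, Nat.find hex = i + 1 := Nat.exists_eq_succ_of_ne_zero fun h => by
    simp only [h] at hk'
    exact hk' h0
  have hlt : i < a.len := by omega
  have hi0 : (σ.1.toOrderHom (Fin.castSucc ⟨i, hlt⟩) : ℕ) = 0 := by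
    by_contra hne
    exact Nat.find_min hex (hi ▸ Nat.lt_succ_self i) ⟨by omega, hne⟩
  have hi1 : (σ.1.toOrderHom (Fin.succ ⟨i, hlt⟩) : ℕ) ≠ 0 := by
    simp only [hi] at hk'
    exact hk'
  have hsurj : Function.Surjective (lowerHom σ.1 (Fin.succ ⟨i, hlt⟩)).toOrderHom := by
    intro y
    obtain ⟨t, ht⟩ := σ.2 (Fin.succ (n := n + 1) y)
    have hle : Fin.succ ⟨i, hlt⟩ ≤ t := by
      by_contra hcon
      have h2 : t ≤ Fin.castSucc ⟨i, hlt⟩ := by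
        rw [Fin.le_def] at hcon ⊢
        simp at hcon ⊢
        omega
      have h3 := Fin.le_def.1 (σ.1.toOrderHom.monotone h2)
      rw [hi0, ht] at h3
      exact absurd h3 (Nat.not_succ_le_zero _)
    obtain ⟨r, rfl⟩ := exists_tailVertex hle
    refine ⟨r, Fin.ext ?_⟩
    have h4 := lowerHom_val σ.1 _ hi1 r
    rw [ht] at h4
    exact (Nat.succ_injective h4).symm
  refine ⟨⟨⟨i, hlt⟩, ⟨_, hsurj⟩⟩, ⟨hi0, lowerHom_val σ.1 _ hi1⟩, ?_⟩
  rintro ⟨j, τ⟩ ⟨hj0, hj1⟩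
  have hj1' := hj1 0
  rw [tailVertex_zero] at hj1'
  -- `i` and `j` both are the last vertex at which `σ` vanishes.
  have hij : j = ⟨i, hlt⟩ := by
    rcases lt_trichotomy j ⟨i, hlt⟩ with hl | hl | hl
    · have h2 := Fin.le_def.1 (σ.1.toOrderHom.monotone
        (show j.succ ≤ Fin.castSucc ⟨i, hlt⟩ from hl))
      dsimp only at hj1'
      omega
    · exact hl
    · have h2 := Fin.le_def.1 (σ.1.toOrderHom.monotone
        (show Fin.succ ⟨i, hlt⟩ ≤ j.castSucc from hl))
      dsimp only at hj0
      omega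
  subst hij
  congr 1
  refine ext_val fun t => ?_
  have h5 := lowerHom_val σ.1 _ hi1 t
  exact Nat.succ_injective ((hj1 t).symm.trans h5)

theorem delooping_spine {c : DegeneracyOp a ⦋n + 1⦌ → M} {i : Fin a.len}
    {τ : DegeneracyOp ⦋a.len - (i.succ : Fin (a.len + 1))⦌ ⦋n⦌} {σ : DegeneracyOp a ⦋n + 1⦌}
    (h : Suspends i.castSucc i.succ τ σ) : delooping c i.castSucc i.succ τ = c σ := by
  classical
  refine Finset.sum_eq_single σ (fun σ' h' hne => ?_) fun h' => ?_
  · exact absurd ((existsUnique_suspends i τ).unique (Finset.mem_filter.1 h').2 h) hne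
  · exact absurd (Finset.mem_filter.2 ⟨Finset.mem_univ _, h⟩) h'

theorem delooping_injective {c d : DegeneracyOp a ⦋n + 1⦌ → M}
    (h : ∀ i : Fin a.len, delooping c i.castSucc i.succ = delooping d i.castSucc i.succ) :
    c = d := by
  funext σ
  obtain ⟨⟨i, τ⟩, hp, -⟩ := existsUnique_desuspension σ
  rw [← delooping_spine (c := c) hp, ← delooping_spine (c := d) hp, h]

theorem exists_delooping_eq
    (x : ∀ i : Fin a.len, DegeneracyOp ⦋a.len - (i.succ : Fin (a.len + 1))⦌ ⦋n⦌ → M) :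
    ∃ c : DegeneracyOp a ⦋n + 1⦌ → M, ∀ i : Fin a.len,
      delooping c i.castSucc i.succ = x i := by
  choose p hp hu using fun σ : DegeneracyOp a ⦋n + 1⦌ => existsUnique_desuspension σ
  refine ⟨fun σ => x (p σ).1 (p σ).2, fun i => ?_⟩
  funext τ
  obtain ⟨σ, hσ, -⟩ := existsUnique_suspends i τ
  rw [delooping_spine hσ, ← hu σ ⟨i, τ⟩ hσ]

end Suspension

end DegeneracyOp

/-! ### The model of `K(P ⋉ A, n)` with objects those of `P` -/

section Model

variable {P : Type u} [Groupoid.{u} P] (A : P ⥤ AddCommGrpCat.{u})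

/-- The `P`-module `x ↦ A(x)^J`. -/
def powerModule (J : Type) : P ⥤ AddCommGrpCat.{u} where
  obj x := AddCommGrpCat.of (J → A.obj x)
  map f := AddCommGrpCat.ofHom (AddMonoidHom.compLeft (A.map f).hom J)
  map_id x := by
    ext a σ
    change A.map (𝟙 x) (a σ) = a σ
    simp
  map_comp f g := by
    ext a σ
    change A.map (f ≫ g) (a σ) = A.map g (A.map f (a σ))
    simp

/-- The semidirect product `P ⋉ A^J`, as a groupoid whose objects are literally those of `P`. -/
def semidirectPower (J : Type) : GroupoidOn P where
  str :=
    { Hom := fun x y => SemidirectHom (A := powerModule A J) ⟨x⟩ ⟨y⟩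
      id := fun x => 𝟙 (⟨x⟩ : Semidirect (powerModule A J))
      comp := fun {x y z} p q => CategoryStruct.comp (X := (⟨x⟩ : Semidirect (powerModule A J)))
        (Y := ⟨y⟩) (Z := ⟨z⟩) p q
      id_comp := fun {x y} p => Category.id_comp (X := (⟨x⟩ : Semidirect (powerModule A J)))
        (Y := ⟨y⟩) p
      comp_id := fun {x y} p => Category.comp_id (X := (⟨x⟩ : Semidirect (powerModule A J)))
        (Y := ⟨y⟩) p
      assoc := fun {w x y z} p q r =>
        Category.assoc (W := (⟨w⟩ : Semidirect (powerModule A J))) (X := ⟨x⟩) (Y := ⟨y⟩) (Z := ⟨z⟩)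
          p q r
      inv := fun {x y} p => Groupoid.inv (X := (⟨x⟩ : Semidirect (powerModule A J))) (Y := ⟨y⟩) p
      inv_comp := fun {x y} p =>
        Groupoid.inv_comp (X := (⟨x⟩ : Semidirect (powerModule A J))) (Y := ⟨y⟩) p
      comp_inv := fun {x y} p =>
        Groupoid.comp_inv (X := (⟨x⟩ : Semidirect (powerModule A J))) (Y := ⟨y⟩) p }

open DegeneracyOp in
/-- The object of `SCrs₁` with objects those of `P` whose arrows `x → y` in dimension `m` are the
pairs of an arrow `x → y` of `P` and a family of elements of `A(y)` indexed by the surjections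
`[m] → [n]`. -/
noncomputable def semidirectSCrs₁ (n : ℕ) : SCrs₁.{u} where
  Obj := P
  lvl :=
    { obj := fun m => semidirectPower A (DegeneracyOp m.unop ⦋n⦌)
      map := fun {m m'} θ =>
        { map := fun {x y} p => (⟨p.base, sumPull θ.unop p.elt⟩ :
            SemidirectHom (A := powerModule A (DegeneracyOp m'.unop ⦋n⦌)) ⟨x⟩ ⟨y⟩)
          map_one := fun x => SemidirectHom.ext rfl (funext fun τ => by
            exact Finset.sum_eq_zero fun _ _ => rfl)
          map_seq := fun {x y z} p q => SemidirectHom.ext rfl (funext fun τ => by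
            refine Finset.sum_add_distrib.trans (congrArg (sumPull θ.unop q.elt τ + ·) ?_)
            exact (map_sumPull (A.map q.base).hom θ.unop p.elt τ).symm) }
      map_id := fun m => GroupoidOn.Hom.ext (by
        funext x y p
        exact SemidirectHom.ext rfl (sumPull_id p.elt))
      map_comp := fun θ φ => GroupoidOn.Hom.ext (by
        funext x y p
        exact SemidirectHom.ext rfl (sumPull_comp θ.unop φ.unop p.elt)) }

/-- `semidirectSCrs₁ A n` as an object of `SCrs₁/P`. -/
noncomputable def semidirectSCrs₁Over (n : ℕ) : Over (SCrs₁.const P) :=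
  Over.mk (Y := semidirectSCrs₁ A n)
    ({ obj := fun x => x
       map := fun p => p.base
       map_one := fun _ _ => rfl
       map_seq := fun _ _ => rfl
       map_act := fun _ _ _ _ => rfl } : SCrs₁.Hom (semidirectSCrs₁ A n) (SCrs₁.const P))

end Model

/-! ### The classifying complex of the model -/

section Delooping

open DegeneracyOp

variable {P : Type u} [Groupoid.{u} P] {A : P ⥤ AddCommGrpCat.{u}} {n : ℕ}

/-- The coefficients in `A(x₀)` of a simplex of `L_P(A, n + 1)`. -/
def HocolimSimplex.coeff {m : SimplexCategoryᵒᵖ}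
    (s : HocolimSimplex (A ⋙ eilenbergMacLaneFunctor (n + 1)) m) :
    DegeneracyOp m.unop ⦋n + 1⦌ → A.obj (s.chain.obj 0) :=
  s.fib

/-- The simplex of the classifying complex that corresponds to a chain `x₀ → ⋯ → x_m` in `P` and a
simplex `c` of `K(A(x₀), n + 1)`: its arrow `x_i → x_j` has the second component
`delooping c i j`, transported from `x₀` to `x_j`. -/
noncomputable def hocolimToWBar {m : SimplexCategoryᵒᵖ}
    (s : HocolimSimplex (A ⋙ eilenbergMacLaneFunctor (n + 1)) m) :
    SCrs₁.WBarSimplex (semidirectSCrs₁ A n) m.unop where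
  vertex i := s.chain.obj i
  arrow i j h :=
    (⟨s.chain.map (homOfLE h), fun τ => A.map (s.chain.map (homOfLE (Fin.zero_le j)))
      (delooping s.coeff i j τ)⟩ :
      SemidirectHom (A := powerModule A (DegeneracyOp ⦋m.unop.len - j⦌ ⦋n⦌)) ⟨_⟩ ⟨_⟩)
  arrow_self i := SemidirectHom.ext (s.chain.map_id i) (funext fun τ => by
    change A.map _ (delooping s.coeff i i τ) = 0
    rw [delooping_self]
    exact map_zero (A.map _).hom)
  arrow_trans i j k hij hjk := SemidirectHom.ext
    (s.chain.map_comp (homOfLE hij) (homOfLE hjk)) (funext fun τ => by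
      have e1 := congrFun (delooping_trans s.coeff i j k hij hjk) τ
      have e2 : s.chain.map (homOfLE (Fin.zero_le k)) =
          s.chain.map (homOfLE (Fin.zero_le j)) ≫ s.chain.map (homOfLE hjk) :=
        s.chain.map_comp (homOfLE (Fin.zero_le j)) (homOfLE hjk)
      refine (congrArg (A.map (s.chain.map (homOfLE (Fin.zero_le k)))) e1).trans ?_
      refine (map_add (A.map (s.chain.map (homOfLE (Fin.zero_le k)))).hom _ _).trans ?_
      refine congrArg (A.map (s.chain.map (homOfLE (Fin.zero_le k)))
        (delooping s.coeff j k τ) + ·) ?_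
      rw [e2, A.map_comp]
      exact congrArg (A.map (s.chain.map (homOfLE hjk))) (map_sumPull
        (A.map (s.chain.map (homOfLE (Fin.zero_le j)))).hom _ _ τ))

theorem hocolimToWBar_pull {m m' : SimplexCategoryᵒᵖ} (θ : m ⟶ m')
    (s : HocolimSimplex (A ⋙ eilenbergMacLaneFunctor (n + 1)) m) :
    hocolimToWBar ((hocolim (A ⋙ eilenbergMacLaneFunctor (n + 1))).map θ s) =
      (hocolimToWBar s).pull θ.unop := by
  refine SCrs₁.WBarSimplex.ext rfl (heq_of_eq ?_)
  funext i j h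
  refine SemidirectHom.ext rfl (funext fun τ => ?_)
  have hθ := θ.unop.toOrderHom.monotone
  have e2 : s.chain.map (homOfLE (Fin.zero_le (θ.unop.toOrderHom j))) =
      s.chain.map (homOfLE (Fin.zero_le (θ.unop.toOrderHom 0))) ≫
        s.chain.map (homOfLE (hθ (Fin.zero_le j))) :=
    s.chain.map_comp (homOfLE (Fin.zero_le _)) (homOfLE (hθ (Fin.zero_le j)))
  change A.map (s.chain.map (homOfLE (hθ (Fin.zero_le j))))
    (delooping (fun σ => (A.map (s.chain.map (homOfLE (Fin.zero_le (θ.unop.toOrderHom 0))))).hom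
      (sumPull θ.unop s.coeff σ)) i j τ) =
    sumPull (tailHom θ.unop j (θ.unop.toOrderHom j) le_rfl) (fun ρ =>
      (A.map (s.chain.map (homOfLE (Fin.zero_le (θ.unop.toOrderHom j))))).hom
        (delooping s.coeff (θ.unop.toOrderHom i)
          (θ.unop.toOrderHom j) ρ)) τ
  rw [← map_delooping, e2, A.map_comp]
  exact (congrArg _ (congrFun (delooping_sumPull s.coeff θ.unop i j) τ)).trans
    (map_sumPull (A.map _ ≫ A.map _).hom _ _ τ)

theorem map_injective_of_groupoid {x y : P} (f : x ⟶ y) : Function.Injective (A.map f) := by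
  intro a b h
  have h' := congrArg (A.map (inv f)) h
  simpa [← CategoryTheory.comp_apply, ← A.map_comp] using h'

theorem hocolimToWBar_injective {m : SimplexCategoryᵒᵖ} : Function.Injective
    (hocolimToWBar (A := A) (n := n) (m := m)) := by
  rintro ⟨X, c⟩ ⟨Y, d⟩ h
  have hX := congrArg (fun t => (SCrs₁.wBarConst P).hom.app m
    ((SCrs₁.wBar.map (semidirectSCrs₁Over A n).hom).app m t)) h
  obtain rfl : X = Y := hX
  congr 1
  refine delooping_injective (M := A.obj (X.obj 0)) fun i => funext fun τ => ?_
  have e := congrFun (congrFun (congrFun (eq_of_heq (SCrs₁.WBarSimplex.ext_iff.1 h).2) i.castSucc)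
    i.succ) (Fin.castSucc_le_succ i)
  exact map_injective_of_groupoid _ (congrFun (congrArg SemidirectHom.elt e) τ)

theorem hocolimToWBar_surjective {m : SimplexCategoryᵒᵖ} : Function.Surjective
    (hocolimToWBar (A := A) (n := n) (m := m)) := by
  intro s
  -- The underlying chain of `s` in `P`.
  let X : ComposableArrows P m.unop.len := (SCrs₁.wBarConst P).hom.app m
    ((SCrs₁.wBar.map (semidirectSCrs₁Over A n).hom).app m s)
  let α : ∀ (i j : Fin (m.unop.len + 1)) (h : i ≤ j), SemidirectHom
    (A := powerModule A (DegeneracyOp ⦋m.unop.len - j⦌ ⦋n⦌)) ⟨X.obj i⟩ ⟨X.obj j⟩ := s.arrow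
  obtain ⟨c, hc⟩ := exists_delooping_eq (M := A.obj (X.obj 0)) (a := m.unop) (n := n) fun i τ =>
    A.map (inv (X.map (homOfLE (Fin.zero_le i.succ))))
      ((α i.castSucc i.succ (Fin.castSucc_le_succ i)).elt τ)
  let t : HocolimSimplex (A ⋙ eilenbergMacLaneFunctor (n + 1)) m := ⟨X, c⟩
  refine ⟨t, ?_⟩
  -- Both simplices have the same spine.
  obtain ⟨a, -, ha⟩ := SCrs₁.WBarSimplex.existsUnique_of_spine (semidirectSCrs₁ A n) m.unop s.vertex
    (fun i => s.arrow i.castSucc i.succ (Fin.castSucc_le_succ i))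
  refine SCrs₁.WBarSimplex.ext rfl (heq_of_eq ?_)
  refine (ha (hocolimToWBar t).arrow ⟨(hocolimToWBar t).arrow_self,
    (hocolimToWBar t).arrow_trans, fun i => ?_⟩).trans
      (ha s.arrow ⟨s.arrow_self, s.arrow_trans, fun i => rfl⟩).symm
  refine SemidirectHom.ext rfl (funext fun τ => ?_)
  have e := congrArg (A.map (X.map (homOfLE (Fin.zero_le i.succ)))) (congrFun (hc i) τ)
  refine e.trans ?_
  rw [← CategoryTheory.comp_apply, ← A.map_comp, IsIso.inv_hom_id, A.map_id]
  rfl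

variable (A n) in
/-- The isomorphism over `Ner(P)` between `L_P(A, n + 1)` and the classifying complex of the model
of `K(P ⋉ A, n)`. -/
noncomputable def wBarSemidirectIso :
    generalizedEilenbergMacLane A (n + 1) ≅
      (SCrs₁.wBarOver P).obj (semidirectSCrs₁Over A n) :=
  Over.isoMk (NatIso.ofComponents
    (fun m => (Equiv.ofBijective (hocolimToWBar (A := A) (n := n) (m := m))
      ⟨hocolimToWBar_injective, hocolimToWBar_surjective⟩).toIso)
    (fun θ => ConcreteCategory.hom_ext _ _ fun s => hocolimToWBar_pull θ s)) rfl

end Delooping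

/-! ### Maps to `K(P ⋉ A, n)` as families of crossed homomorphisms -/

section Coordinates

open DegeneracyOp

attribute [local instance] Over.cartesianMonoidalCategory Over.braidedCategory

variable {P : Type u} [Groupoid.{u} P] {A : P ⥤ AddCommGrpCat.{u}}

/-- The crossed homomorphism that corresponds to a morphism to `P ⋉ A`. -/
def crossedHomOf {Y : Over (Grpd.of P)} (f : Y ⟶ semidirectOver A) :
    crossedHoms (T := Y.left) A Y.hom :=
  (semidirectRepresentableBy A).homEquiv f

theorem crossedHomOf_injective {Y : Over (Grpd.of P)} :
    Function.Injective (crossedHomOf (A := A) (Y := Y)) :=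
  (semidirectRepresentableBy A).homEquiv.injective

theorem crossedHomOf_comp {Y Y' : Over (Grpd.of P)} (g : Y ⟶ Y') (f : Y' ⟶ semidirectOver A) :
    crossedHomOf (g ≫ f) = crossedHomsComp A g.left (Over.w g) (crossedHomOf f) :=
  (semidirectRepresentableBy A).homEquiv_comp g f

open MonObj in
/-- The group structure of `Hom(Y, P ⋉ A)` is the addition of crossed homomorphisms. -/
theorem crossedHomOf_prod {Y : Over (Grpd.of P)} {J : Type*} (s : Finset J)
    (f : J → (Y ⟶ semidirectOver A)) :
    crossedHomOf (∏ i ∈ s, f i) = ∑ i ∈ s, crossedHomOf (f i) := by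
  let φ : (Y ⟶ semidirectOver A) →* Multiplicative (crossedHoms (T := Y.left) A Y.hom) :=
    ((yonedaMonObjIsoOfRepresentableBy (semidirectOver A)
      (crossedHomPresheaf A ⋙ forget₂ CommGrpCat GrpCat ⋙ forget₂ GrpCat MonCat)
        (semidirectRepresentableBy A)).hom.app (op Y)).hom
  exact map_prod φ f s

theorem sumPull_crossedHoms_apply {T : Type u} [Groupoid.{u} T] {p : T ⥤ P}
    {a a' b : SimplexCategory} (θ : a' ⟶ a) (d : DegeneracyOp a b → crossedHoms A p)
    (τ : DegeneracyOp a' b) (x y : T) (k : x ⟶ y) :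
    (sumPull θ d τ).1 x y k = sumPull θ (fun σ => (d σ).1 x y k) τ :=
  map_sumPull (AddMonoidHom.mk' (fun t : crossedHoms A p => t.1 x y k) fun _ _ => rfl) θ d τ

theorem crossedHoms.map_id {T : Type u} [Groupoid.{u} T] {p : T ⥤ P} (d : crossedHoms A p)
    (x : T) : d.1 x x (𝟙 x) = 0 := by
  have h := d.2 (𝟙 x) (𝟙 x)
  rw [Category.comp_id, p.map_id, A.map_id, CategoryTheory.id_apply] at h
  exact left_eq_add.1 h

/-- The projection `P ⋉ A^J → P ⋉ A` to the factor at `σ`. -/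
def semidirectPowerProj (A : P ⥤ AddCommGrpCat.{u}) {J : Type} (σ : J) :
    semidirectOver (powerModule A J) ⟶ semidirectOver A :=
  Over.homMk
    (CategoryTheory.Functor.mk (C := Semidirect (powerModule A J)) (D := Semidirect A)
      (fun x => ⟨x.pt⟩) (fun p => ⟨p.base, p.elt σ⟩) (fun _ => rfl) (fun _ _ => rfl)) rfl

theorem crossedHomOf_comp_proj {Y : Over (Grpd.of P)} {J : Type}
    (f : Y ⟶ semidirectOver (powerModule A J)) (σ : J) (x y : Y.left) (k : x ⟶ y) :
    (crossedHomOf (f ≫ semidirectPowerProj A σ)).1 x y k = (crossedHomOf f).1 x y k σ := by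
  have key : ∀ {z z' : P} (h : z = z') (a : J → A.obj z),
      A.map (eqToHom h) (a σ) = (powerModule A J).map (eqToHom h) a σ := by
    intro z z' h a
    rfl
  exact key _ _

/-- The morphism to `P ⋉ A^J` that corresponds to a family of crossed homomorphisms. -/
def semidirectPowerLift {Y : Over (Grpd.of P)} {J : Type}
    (d : J → crossedHoms (T := Y.left) A Y.hom) : Y ⟶ semidirectOver (powerModule A J) :=
  (semidirectRepresentableBy (powerModule A J)).homEquiv.symm
    (⟨fun x y k σ => (d σ).1 x y k, fun f g => funext fun σ => (d σ).2 f g⟩ :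
      crossedHoms (T := Y.left) (powerModule A J) Y.hom)

theorem crossedHomOf_semidirectPowerLift {Y : Over (Grpd.of P)} {J : Type}
    (d : J → crossedHoms (T := Y.left) A Y.hom) (σ : J) (x y : Y.left) (k : x ⟶ y) :
    (crossedHomOf (semidirectPowerLift d)).1 x y k σ = (d σ).1 x y k :=
  congrArg (fun t : crossedHoms (T := Y.left) (powerModule A J) Y.hom => t.1 x y k σ)
    ((semidirectRepresentableBy (powerModule A J)).homEquiv.apply_symm_apply _)

/-- `P ⋉ A^J` is a product over `P` of copies of `P ⋉ A`. -/
def semidirectPowerIsLimit (A : P ⥤ AddCommGrpCat.{u}) (J : Type) :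
    IsLimit (Fan.mk (semidirectOver (powerModule A J)) (semidirectPowerProj A (J := J))) :=
  Fan.IsLimit.mk _
    (fun s => semidirectPowerLift fun σ => crossedHomOf (s.proj σ))
    (fun s σ => by
      apply crossedHomOf_injective
      apply Subtype.ext
      funext x y k
      exact (crossedHomOf_comp_proj _ σ x y k).trans (crossedHomOf_semidirectPowerLift _ σ x y k))
    (fun s f hf => by
      apply crossedHomOf_injective
      apply Subtype.ext
      funext x y k σ
      refine (crossedHomOf_comp_proj f σ x y k).symm.trans ?_
      refine Eq.trans ?_ (crossedHomOf_semidirectPowerLift _ σ x y k).symm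
      exact congrArg (fun t : s.pt ⟶ semidirectOver A => (crossedHomOf t).1 x y k) (hf σ))

/-- The crossed homomorphisms that correspond to the components of a morphism to `K(P ⋉ A, n)`. -/
noncomputable def emCoord {n : ℕ} {Y : Over (Grpd.of P)} {m : SimplexCategoryᵒᵖ}
    (f : Y ⟶ (semidirectEilenbergMacLane A n).obj m) (σ : DegeneracyOp m.unop ⦋n⦌) :
    crossedHoms (T := Y.left) A Y.hom :=
  crossedHomOf (f ≫ Pi.π (fun _ : DegeneracyOp m.unop ⦋n⦌ => semidirectOver A) σ)

variable {n : ℕ}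

theorem emCoord_injective {Y : Over (Grpd.of P)} {m : SimplexCategoryᵒᵖ} :
    Function.Injective (emCoord (A := A) (n := n) (Y := Y) (m := m)) := by
  intro f g h
  apply Pi.hom_ext
  intro σ
  exact crossedHomOf_injective (congrFun h σ)

theorem emCoord_comp {Y Y' : Over (Grpd.of P)} {m : SimplexCategoryᵒᵖ} (g : Y ⟶ Y')
    (f : Y' ⟶ (semidirectEilenbergMacLane A n).obj m) (σ : DegeneracyOp m.unop ⦋n⦌) :
    emCoord (g ≫ f) σ = crossedHomsComp A g.left (Over.w g) (emCoord f σ) := by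
  exact (congrArg crossedHomOf (Category.assoc _ _ _)).trans (crossedHomOf_comp _ _)

theorem emCoord_comp_map {Y : Over (Grpd.of P)} {m m' : SimplexCategoryᵒᵖ}
    (f : Y ⟶ (semidirectEilenbergMacLane A n).obj m) (θ : m ⟶ m') :
    emCoord (f ≫ (semidirectEilenbergMacLane A n).map θ) = sumPull θ.unop (emCoord f) := by
  funext τ
  refine (congrArg crossedHomOf (Category.assoc _ _ _)).trans ?_
  refine (congrArg (fun g => crossedHomOf (f ≫ g)) (Pi.lift_π _ τ)).trans ?_
  exact (congrArg crossedHomOf (comp_finset_prod _ _ _ _)).trans (crossedHomOf_prod _ _)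

/-- The degree `m` part of `K(P ⋉ A, n)` is `P ⋉ A^J`, where `J` is the set of surjections
`[m] → [n]`. -/
noncomputable def emObjIso (A : P ⥤ AddCommGrpCat.{u}) (n : ℕ) (m : SimplexCategoryᵒᵖ) :
    (semidirectEilenbergMacLane A n).obj m ≅
      semidirectOver (powerModule A (DegeneracyOp m.unop ⦋n⦌)) :=
  (limit.isLimit (Discrete.functor fun _ : DegeneracyOp m.unop ⦋n⦌ =>
    semidirectOver A)).conePointUniqueUpToIso
      (semidirectPowerIsLimit A (DegeneracyOp m.unop ⦋n⦌))

theorem emObjIso_hom_proj {m : SimplexCategoryᵒᵖ} (σ : DegeneracyOp m.unop ⦋n⦌) :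
    (emObjIso A n m).hom ≫ semidirectPowerProj A σ =
      Pi.π (fun _ : DegeneracyOp m.unop ⦋n⦌ => semidirectOver A) σ :=
  IsLimit.conePointUniqueUpToIso_hom_comp _ (semidirectPowerIsLimit A (DegeneracyOp m.unop ⦋n⦌))
    ⟨σ⟩

/-- The value of the component at `σ` of a morphism from the degree `m` part of `S` to that of
`K(P ⋉ A, n)` at an arrow of `S`. -/
noncomputable def emArr {S : Over (SCrs₁.const P)} {m : SimplexCategoryᵒᵖ}
    (f : (SCrs₁.overIncl S).obj m ⟶ (semidirectEilenbergMacLane A n).obj m)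
    (σ : DegeneracyOp m.unop ⦋n⦌) {x y : S.left.Obj} (p : S.left.Arr m.unop x y) :
    A.obj (S.hom.obj y) :=
  (emCoord f σ).1 x y p

/-- A family of morphisms from the groupoids of `S` to those of `K(P ⋉ A, n)` is compatible with
an operator if and only if its components are. -/
theorem overIncl_naturality_iff {S : Over (SCrs₁.const P)} {m m' : SimplexCategoryᵒᵖ} (θ : m ⟶ m')
    (f : (SCrs₁.overIncl S).obj m ⟶ (semidirectEilenbergMacLane A n).obj m)
    (f' : (SCrs₁.overIncl S).obj m' ⟶ (semidirectEilenbergMacLane A n).obj m') :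
    (SCrs₁.overIncl S).map θ ≫ f' = f ≫ (semidirectEilenbergMacLane A n).map θ ↔
      ∀ (τ : DegeneracyOp m'.unop ⦋n⦌) (x y : S.left.Obj) (p : S.left.Arr m.unop x y),
        emArr f' τ (S.left.act θ.unop p) = sumPull θ.unop (fun σ => emArr f σ p) τ := by
  have h1 : ∀ (τ : DegeneracyOp m'.unop ⦋n⦌) (x y : S.left.Obj) (p : S.left.Arr m.unop x y),
      (emCoord ((SCrs₁.overIncl S).map θ ≫ f') τ).1 x y p =
        emArr f' τ (S.left.act θ.unop p) := by
    intro τ x y p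
    rw [emCoord_comp]
    have key : ∀ (z : P) (a : A.obj z), A.map (𝟙 z) a = a := fun z a => by simp
    exact key (S.hom.obj y) (emArr f' τ (S.left.act θ.unop p))
  have h2 : ∀ (τ : DegeneracyOp m'.unop ⦋n⦌) (x y : S.left.Obj) (p : S.left.Arr m.unop x y),
      (emCoord (f ≫ (semidirectEilenbergMacLane A n).map θ) τ).1 x y p =
        sumPull θ.unop (fun σ => emArr f σ p) τ := by
    intro τ x y p
    rw [emCoord_comp_map]
    exact sumPull_crossedHoms_apply (T := ((SCrs₁.overIncl S).obj m).left) θ.unop (emCoord f) τ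
      x y p
  constructor
  · intro h τ x y p
    exact (h1 τ x y p).symm.trans ((congrArg (fun g => (emCoord g τ).1 x y p) h).trans (h2 τ x y p))
  · intro h
    apply emCoord_injective
    funext τ
    apply Subtype.ext
    funext x y p
    exact (h1 τ x y p).trans ((h τ x y p).trans (h2 τ x y p).symm)

/-! ### `K(P ⋉ A, n)` belongs to `SCrs₁/P` -/

/-- The groupoids of `semidirectSCrs₁ A n` are the semidirect products `P ⋉ A^J`. -/
noncomputable def overInclSemidirectIso (A : P ⥤ AddCommGrpCat.{u}) (n : ℕ)
    (m : SimplexCategoryᵒᵖ) :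
    (SCrs₁.overIncl (semidirectSCrs₁Over A n)).obj m ≅
      semidirectOver (powerModule A (DegeneracyOp m.unop ⦋n⦌)) :=
  Over.isoMk
    { hom := CategoryTheory.Functor.mk
        (C := (semidirectPower A (DegeneracyOp m.unop ⦋n⦌)).Carrier)
        (D := Semidirect (powerModule A (DegeneracyOp m.unop ⦋n⦌)))
        (fun x => ⟨x⟩) (fun p => p) (fun _ => rfl) (fun _ _ => rfl)
      inv := CategoryTheory.Functor.mk
        (C := Semidirect (powerModule A (DegeneracyOp m.unop ⦋n⦌)))
        (D := (semidirectPower A (DegeneracyOp m.unop ⦋n⦌)).Carrier)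
        (fun x => x.pt) (fun p => p) (fun _ => rfl) (fun _ _ => rfl)
      hom_inv_id := rfl
      inv_hom_id := rfl } rfl

theorem emArr_overInclSemidirectIso {m : SimplexCategoryᵒᵖ} (σ : DegeneracyOp m.unop ⦋n⦌)
    (x y : P) (p : SemidirectHom (A := powerModule A (DegeneracyOp m.unop ⦋n⦌)) ⟨x⟩ ⟨y⟩) :
    emArr (S := semidirectSCrs₁Over A n) (x := x) (y := y)
      ((overInclSemidirectIso A n m).hom ≫ (emObjIso A n m).inv) σ p = p.elt σ := by
  have e : ((overInclSemidirectIso A n m).hom ≫ (emObjIso A n m).inv) ≫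
      Pi.π (fun _ : DegeneracyOp m.unop ⦋n⦌ => semidirectOver A) σ =
        (overInclSemidirectIso A n m).hom ≫ semidirectPowerProj A σ := by
    rw [← emObjIso_hom_proj]
    simp
  refine (congrArg (fun f => (crossedHomOf f).1 x y p) e).trans ?_
  change A.map (𝟙 y) (p.elt σ) = p.elt σ
  simp

variable (A n) in
/-- The object `semidirectSCrs₁Over A n` of `SCrs₁/P` is a model of `K(P ⋉ A, n)`. -/
noncomputable def overInclSemidirectIsoEilenbergMacLane :
    SCrs₁.overIncl (semidirectSCrs₁Over A n) ≅ semidirectEilenbergMacLane A n :=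
  NatIso.ofComponents (fun m => overInclSemidirectIso A n m ≪≫ (emObjIso A n m).symm) (by
    intro m m' θ
    refine (overIncl_naturality_iff θ _ _).2 fun τ x y p => ?_
    refine (emArr_overInclSemidirectIso (P := P) (A := A) τ x y _).trans ?_
    exact congrArg (fun t => sumPull θ.unop t τ)
      (funext fun σ => (emArr_overInclSemidirectIso (P := P) (A := A) σ x y p).symm))

end Coordinates

/-! ### Bijective morphisms of `SCrs₁` -/

section Bijective

/-- An isomorphism of groupoids is bijective on objects. -/
theorem Grpd.bijective_obj {C D : Grpd.{u, u}} (f : C ⟶ D) [IsIso f] :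
    Function.Bijective (fun x : C => f.obj x) :=
  Function.bijective_iff_has_inverse.2 ⟨fun y : D => (inv f).obj y,
    fun x => Functor.congr_obj (IsIso.hom_inv_id f) x,
    fun y => Functor.congr_obj (IsIso.inv_hom_id f) y⟩

/-- An isomorphism of groupoids is bijective on arrows. -/
theorem Grpd.bijective_map {C D : Grpd.{u, u}} (f : C ⟶ D) [IsIso f] (x y : C) :
    Function.Bijective (fun p : x ⟶ y => f.map p) := by
  let e : C ≌ D := CategoryTheory.Equivalence.mk (C := C) (D := D) f (inv f)
    (eqToIso (IsIso.hom_inv_id f).symm) (eqToIso (IsIso.inv_hom_id f))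
  exact e.fullyFaithfulFunctor.map_bijective x y

namespace SCrs₁

/-- A morphism that is bijective on objects and on arrows induces an isomorphism of classifying
complexes. -/
theorem isIso_wBar_map {S T : SCrs₁.{u}} (F : S ⟶ T) (hobj : Function.Bijective F.obj)
    (hmap : ∀ (m : SimplexCategory) (x y : S.Obj),
      Function.Bijective (fun p : S.Arr m x y => F.map p)) : IsIso (wBar.map F) := by
  rw [NatTrans.isIso_iff_isIso_app]
  intro n
  rw [isIso_iff_bijective]
  constructor
  · rintro ⟨x, a, a0, a1⟩ ⟨y, b, b0, b1⟩ h
    have hx := (WBarSimplex.ext_iff.1 h).1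
    obtain rfl : x = y := funext fun i => hobj.1 (congrFun hx i)
    have ha := eq_of_heq (WBarSimplex.ext_iff.1 h).2
    refine WBarSimplex.ext rfl (heq_of_eq ?_)
    funext i j hij
    exact (hmap _ _ _).1 (congrFun (congrFun (congrFun ha i) j) hij)
  · rintro ⟨y, b, b0, b1⟩
    choose x hx using fun i => hobj.2 (y i)
    obtain rfl : (fun i => F.obj (x i)) = y := funext hx
    choose a ha using fun i j hij => (hmap _ (x i) (x j)).2 (b i j hij)
    refine ⟨⟨x, a, fun i => (hmap _ _ _).1 ?_, fun i j k hij hjk => (hmap _ _ _).1 ?_⟩, ?_⟩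
    · exact (ha i i le_rfl).trans ((b0 i).trans (F.map_one _ _).symm)
    · refine (ha i k _).trans ((b1 i j k hij hjk).trans ?_)
      refine Eq.trans ?_ (F.map_seq _ _).symm
      refine congrArg₂ T.seq ?_ (ha j k hjk).symm
      exact (congrArg (T.act _) (ha i j hij)).symm.trans (F.map_act _ _).symm
    · refine WBarSimplex.ext rfl (heq_of_eq ?_)
      funext i j hij
      exact ha i j hij

end SCrs₁

end Bijective

/-! ### Comparison of an arbitrary model with the standard one -/

section Comparison

open DegeneracyOp

attribute [local instance] Over.cartesianMonoidalCategory Over.braidedCategory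

variable {P : Type u} [Groupoid.{u} P] {A : P ⥤ AddCommGrpCat.{u}} {n : ℕ}
  {S : Over (SCrs₁.const P)} (Φ : SCrs₁.overIncl S ≅ semidirectEilenbergMacLane A n)

/-- The morphism to the standard model given by the components of an isomorphism to
`K(P ⋉ A, n)`. -/
noncomputable def compareHom : SCrs₁.Hom S.left (semidirectSCrs₁ A n) where
  obj x := S.hom.obj x
  map {m x y} p := (⟨S.hom.map p, fun σ => emArr (Φ.hom.app (op m)) σ p⟩ :
    SemidirectHom (A := powerModule A (DegeneracyOp m ⦋n⦌)) ⟨S.hom.obj x⟩ ⟨S.hom.obj y⟩)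
  map_one m x := SemidirectHom.ext (S.hom.map_one m x) (funext fun σ =>
    crossedHoms.map_id (emCoord (Φ.hom.app (op m)) σ) x)
  map_seq {m _ _ _} p q := SemidirectHom.ext (S.hom.map_seq p q) (funext fun σ =>
    (emCoord (Φ.hom.app (op m)) σ).2 p q)
  map_act θ x y p := SemidirectHom.ext (S.hom.map_act θ p) (funext fun τ =>
    (overIncl_naturality_iff θ.op _ _).1 (Φ.hom.naturality θ.op) τ x y p)

/-- The groupoids of a model of `K(P ⋉ A, n)` are isomorphic to the semidirect products
`P ⋉ A^J`. -/
noncomputable def levelIso (m : SimplexCategoryᵒᵖ) : ((SCrs₁.overIncl S).obj m).left ≅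
    (semidirectOver (powerModule A (DegeneracyOp m.unop ⦋n⦌))).left :=
  (Over.forget _).mapIso (Φ.app m ≪≫ emObjIso A n m)

/-- In each degree, `compareHom Φ` is the composite of `Φ` with the isomorphism from
`K(P ⋉ A, n)_m` to `P ⋉ A^J`. -/
theorem levelIso_hom (m : SimplexCategoryᵒᵖ) :
    (levelIso Φ m).hom =
      CategoryTheory.Functor.mk (C := (S.left.lvl.obj m).Carrier)
        (D := Semidirect (powerModule A (DegeneracyOp m.unop ⦋n⦌)))
        (fun x => ⟨S.hom.obj x⟩)
        (fun {x y} p => (compareHom Φ).map (m := m.unop) (x := x) (y := y) p)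
        (fun x => (compareHom Φ).map_one m.unop x) (fun p q => (compareHom Φ).map_seq p q) := by
  have e : Φ.hom.app m ≫ (emObjIso A n m).hom =
      semidirectPowerLift fun σ => emCoord (Φ.hom.app m) σ := by
    apply crossedHomOf_injective
    apply Subtype.ext
    funext x y p σ
    refine Eq.trans ?_ (crossedHomOf_semidirectPowerLift _ σ x y p).symm
    refine (crossedHomOf_comp_proj _ σ x y p).symm.trans ?_
    have e' : (Φ.hom.app m ≫ (emObjIso A n m).hom) ≫ semidirectPowerProj A σ =
        Φ.hom.app m ≫ Pi.π (fun _ : DegeneracyOp m.unop ⦋n⦌ => semidirectOver A) σ :=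
      (Category.assoc _ _ _).trans (congrArg (Φ.hom.app m ≫ ·) (emObjIso_hom_proj σ))
    exact congrArg (fun f => (crossedHomOf f).1 x y p) e'
  exact congrArg (fun f => f.left) e

theorem compareHom_bijective_obj : Function.Bijective (compareHom Φ).obj := by
  have h := Grpd.bijective_obj (levelIso Φ (op ⦋0⦌)).hom
  rw [levelIso_hom] at h
  refine ⟨fun x y e => h.1 ?_, fun (y : P) => ?_⟩
  · have e' : S.hom.obj x = S.hom.obj y := e
    exact congrArg (fun z : P => (⟨z⟩ : Semidirect (powerModule A (DegeneracyOp ⦋0⦌ ⦋n⦌)))) e'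
  · obtain ⟨x, e⟩ := h.2 (⟨y⟩ : Semidirect (powerModule A (DegeneracyOp ⦋0⦌ ⦋n⦌)))
    have e' : S.hom.obj x = y := congrArg
      (fun z : Semidirect (P := P) (powerModule A (DegeneracyOp ⦋0⦌ ⦋n⦌)) => z.pt) e
    exact ⟨x, e'⟩

theorem compareHom_bijective_map (m : SimplexCategory) (x y : S.left.Obj) :
    Function.Bijective (fun p : S.left.Arr m x y => (compareHom Φ).map p) := by
  have h := Grpd.bijective_map (levelIso Φ (op m)).hom x y
  rw [levelIso_hom] at h
  exact h

/-- The classifying complex of any model is isomorphic over `Ner(P)` to that of the standard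
one. -/
noncomputable def wBarOverCompareIso :
    (SCrs₁.wBarOver P).obj S ≅ (SCrs₁.wBarOver P).obj (semidirectSCrs₁Over A n) :=
  let F : S.left ⟶ (semidirectSCrs₁Over A n).left := compareHom Φ
  have : IsIso (SCrs₁.wBar.map F) := SCrs₁.isIso_wBar_map F (compareHom_bijective_obj Φ)
    (compareHom_bijective_map Φ)
  have e : SCrs₁.wBar.map F ≫ ((SCrs₁.wBarOver P).obj (semidirectSCrs₁Over A n)).hom =
    ((SCrs₁.wBarOver P).obj S).hom := rfl
  let i := asIso (SCrs₁.wBar.map F)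
  Over.isoMk i e

end Comparison

/-- For a `P`-module `A`, the simplicial groupoid `K(P ⋉ A, n)` over `P` belongs to `SCrs₁/P`, and
its classifying complex is isomorphic, over `Ner(P)`, to `L_P(A, n + 1)`. -/
theorem mainTheorem11 (P : Type u) [Groupoid.{u} P] (A : P ⥤ AddCommGrpCat.{u}) (n : ℕ) :
    (∃ S : Over (SCrs₁.const P),
      Nonempty (SCrs₁.overIncl S ≅ semidirectEilenbergMacLane A n)) ∧
    ∀ S : Over (SCrs₁.const P),
      Nonempty (SCrs₁.overIncl S ≅ semidirectEilenbergMacLane A n) →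
        Nonempty ((SCrs₁.wBarOver P).obj S ≅ generalizedEilenbergMacLane A (n + 1)) :=
  ⟨⟨semidirectSCrs₁Over A n, ⟨overInclSemidirectIsoEilenbergMacLane A n⟩⟩,
    fun _ ⟨Φ⟩ => ⟨wBarOverCompareIso Φ ≪≫ (wBarSemidirectIso A n).symm⟩⟩
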